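/- Let $\mathcal H$ be a finite-dimensional complex Hilbert space with orthonormal basis $(e_i)$ and dual basis $(x_i)$. For each $k$ let $S^k(\mathcal H)\subseteq\mathcal H^{\otimes k}$ be the symmetric subspace, with orthogonal projection $\Pi_k$, and identify $S^\bullet(\mathcal H^*)$ with the polynomial ring in the $x_i$. Let $H$ be a Hermitian form of bidegree $(d,d)$, i.e. a Hermitian operator on $S^d(\mathcal H)$, and write $H(z,z^*)=\langle z^{\otimes d},H z^{\otimes d}\rangle$. Let $I\subseteq S^\bullet(\mathcal H^*)$ be a homogeneous ideal with degree-$k$ components $I_k\subseteq S^k(\mathcal H^*)$, and let $V(I)=\{zz^* : \|z\|=1,\ f(z)=0 \text{ for all } f\in I\}$. For $k\ge d$ let $$H_k=\Pi_k\bigl(H\otimes \mathbb 1_{\mathcal H}^{\otimes (k-d)}\bigr)\Pi_k ,$$ the Hermitian operator on $S^k(\mathcal H)$ whose form is $\langle z^{\otimes k},H_k z^{\otimes k}\rangle=H(z,z^*)\|z\|^{2(k-d)}$. Let $I_k^\perp\subseteq S^k(\mathcal H)$ be the annihilator of $I_k$ under the bilinear pairing, let $\Pi_{I,k}$ be the orthogonal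 projection of $S^k(\mathcal H)$ onto $I_k^\perp$, and let $\nu_k$ be the minimum eigenvalue of $\Pi_{I,k}H_k\Pi_{I,k}$ regarded as an operator on $I_k^\perp$ (with $\nu_k=+\infty$ if $I_k^\perp=0$). Then $\nu_d\le\nu_{d+1}\le\cdots$, and $$\lim_{k\to\infty}\nu_k=\min_{zz^*\in V(I)}H(z,z^*),$$ where the right-hand side is $+\infty$ if $V(I)=\emptyset$. If $V(I)\neq\emptyset$, then every $\nu_k$ is finite and the minimum on the right is attained. -/

import Mathlib

attribute [local instance] MvPolynomial.gradedAlgebra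

namespace HermitianHierarchy

open scoped BigOperators

/-- The Hilbert space `𝓗^{⊗k}`, where `𝓗` has an orthonormal basis `(e_i)` indexed by `ι`: a tensor is
given by its coordinates in the orthonormal basis `e_{w 0} ⊗ ⋯ ⊗ e_{w (k-1)}`. The same type serves
for `(𝓗^*)^{⊗k}`, with coordinates in the products of the dual basis `(x_i)`. -/
abbrev TensorPow (ι : Type*) (k : ℕ) : Type _ := EuclideanSpace ℂ (Fin k → ι)

/-- The symmetric subspace `S^k(𝓗)` of `𝓗^{⊗k}`: the tensors fixed by all permutations of the
tensor factors. -/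
def symSubspace (ι : Type*) (k : ℕ) : Submodule ℂ (TensorPow ι k) where
  carrier := {v | ∀ (σ : Equiv.Perm (Fin k)) (w : Fin k → ι), v (w ∘ σ) = v w}
  zero_mem' := by
    intro σ w
    simp
  add_mem' := by
    intro u v hu hv σ w
    simp [hu σ w, hv σ w]
  smul_mem' := by
    intro c v hv σ w
    simp [hv σ w]

section Vectors

variable {ι E : Type*} [Fintype ι] [NormedAddCommGroup E] [InnerProductSpace ℂ E]

/-- The tensor power `z^{⊗k}` of a vector `z`, as an element of `S^k(𝓗)`. -/
noncomputable def vecPow (b : OrthonormalBasis ι ℂ E) (k : ℕ) (z : E) : symSubspace ι k :=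
  ⟨WithLp.toLp 2 (fun w => ∏ j, b.repr z (w j)), by
    intro σ w
    exact Equiv.prod_comp σ (fun j => b.repr z (w j))⟩

/-- The value `H(z, z^*) = ⟨z^{⊗d}, H z^{⊗d}⟩` of a Hermitian form `H` of bidegree `(d, d)`;
it is a real number when `H` is Hermitian. -/
noncomputable def formValue (b : OrthonormalBasis ι ℂ E) {d : ℕ}
    (H : symSubspace ι d →ₗ[ℂ] symSubspace ι d) (z : E) : ℝ :=
  (inner ℂ (vecPow b d z) (H (vecPow b d z))).re

/-- The projective variety `V(I)`: the set of pure states `z z^*` (`z` a unit vector) with `f(z) = 0`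
for all `f ∈ I`. Here `S^•(𝓗^*)` is the polynomial ring in the dual basis `(x_i)`. -/
def projVariety (b : OrthonormalBasis ι ℂ E) (I : Ideal (MvPolynomial ι ℂ)) : Set (E →L[ℂ] E) :=
  {P | ∃ z : E, ‖z‖ = 1 ∧ (∀ f ∈ I, MvPolynomial.eval (fun i => b.repr z i) f = 0) ∧
    P = InnerProductSpace.rankOne ℂ z z}

end Vectors

section Operators

variable {ι : Type*} [Fintype ι]

/-- The homogeneous polynomial of degree `k` given by a tensor `T ∈ (𝓗^*)^{⊗k}`: the linear map with
`ℓ_1 ⊗ ⋯ ⊗ ℓ_k ↦ ℓ_1 ⋯ ℓ_k`. On `S^k(𝓗^*)` it is the usual isomorphism with the forms of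
degree `k`. -/
noncomputable def tensorPoly {k : ℕ} (T : TensorPow ι k) : MvPolynomial ι ℂ :=
  ∑ w : Fin k → ι, MvPolynomial.C (T w) * ∏ j, MvPolynomial.X (w j)

/-- `I_k^⊥ ⊆ S^k(𝓗)`: the annihilator of the degree-`k` component `I_k ⊆ S^k(𝓗^*)` of `I` under the
bilinear pairing of `(𝓗^*)^{⊗k}` with `𝓗^{⊗k}`. -/
def idealPerp (I : Ideal (MvPolynomial ι ℂ)) (k : ℕ) : Submodule ℂ (symSubspace ι k) where
  carrier := {v | ∀ T ∈ symSubspace ι k, tensorPoly T ∈ I →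
    ∑ w : Fin k → ι, T w * (v : TensorPow ι k) w = 0}
  zero_mem' := by
    intro T _ _
    simp
  add_mem' := by
    intro u v hu hv T hT hI
    simp [mul_add, Finset.sum_add_distrib, hu T hT hI, hv T hT hI]
  smul_mem' := by
    intro c v hv T hT hI
    have h := hv T hT hI
    simp only [SetLike.val_smul, PiLp.smul_apply, smul_eq_mul, mul_left_comm _ c]
    rw [← Finset.mul_sum, h, mul_zero]

/-- An operator on `S^d(𝓗)` as an operator on `𝓗^{⊗d}`, set to zero on the orthogonal complement
of `S^d(𝓗)`. -/
noncomputable def extendSym {d : ℕ} (H : symSubspace ι d →ₗ[ℂ] symSubspace ι d) :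
    TensorPow ι d →ₗ[ℂ] TensorPow ι d :=
  (symSubspace ι d).subtype ∘ₗ H ∘ₗ (symSubspace ι d).orthogonalProjectionOnto.toLinearMap

/-- The tensor in the first `d` factors obtained from `v ∈ 𝓗^{⊗(d+m)}` by fixing the indices of the
last `m` factors to be `u`. -/
def sliceLast (d m : ℕ) (u : Fin m → ι) : TensorPow ι (d + m) →ₗ[ℂ] TensorPow ι d where
  toFun v := WithLp.toLp 2 (fun a => v (Fin.append a u))
  map_add' _ _ := rfl
  map_smul' _ _ := rfl

/-- The operator `A ⊗ 𝟙^{⊗m}` on `𝓗^{⊗(d+m)}`, with `A` acting on the first `d` factors. -/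
def tensorId {d : ℕ} (A : TensorPow ι d →ₗ[ℂ] TensorPow ι d) (m : ℕ) :
    TensorPow ι (d + m) →ₗ[ℂ] TensorPow ι (d + m) where
  toFun v := WithLp.toLp 2 (fun w =>
    A (sliceLast d m (fun j => w (Fin.natAdd d j)) v) (fun i => w (Fin.castAdd m i)))
  map_add' u v := by
    ext w
    simp
  map_smul' c v := by
    ext w
    simp

/-- The operator `H_k = Π_k (H ⊗ 𝟙^{⊗(k-d)}) Π_k` on `S^k(𝓗)` for `k = d + m`, where `Π_k` is the
orthogonal projection of `𝓗^{⊗k}` onto `S^k(𝓗)`. It is the Hermitian form `H(z, z^*) ‖z‖^{2(k-d)}`;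
see `inner_liftForm`. -/
noncomputable def liftForm {d : ℕ} (H : symSubspace ι d →ₗ[ℂ] symSubspace ι d) (m : ℕ) :
    symSubspace ι (d + m) →ₗ[ℂ] symSubspace ι (d + m) :=
  (symSubspace ι (d + m)).orthogonalProjectionOnto.toLinearMap ∘ₗ tensorId (extendSym H) m ∘ₗ
    (symSubspace ι (d + m)).subtype

/-- The operator `Π_K T Π_K`, regarded as an operator on the subspace `K` onto which the orthogonal
projection `Π_K` projects. -/
noncomputable def compression {V : Type*} [NormedAddCommGroup V] [InnerProductSpace ℂ V]
    (K : Submodule ℂ V) [K.HasOrthogonalProjection] (T : V →ₗ[ℂ] V) : K →ₗ[ℂ] K :=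
  K.orthogonalProjectionOnto.toLinearMap ∘ₗ T ∘ₗ K.subtype

/-- The smallest real eigenvalue of an operator (all eigenvalues are real for a Hermitian one), with
value `+∞` if there is none, as on the zero space. -/
noncomputable def minEigenvalue {V : Type*} [AddCommGroup V] [Module ℂ V] (T : V →ₗ[ℂ] V) : EReal :=
  ⨅ μ ∈ {μ : ℝ | Module.End.HasEigenvalue T (μ : ℂ)}, (μ : EReal)

/-- `Π_{I,k} H_k Π_{I,k}` for `k = d + m`, as an operator on `I_k^⊥`. -/
noncomputable def idealCompression {d : ℕ} (I : Ideal (MvPolynomial ι ℂ))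
    (H : symSubspace ι d →ₗ[ℂ] symSubspace ι d) (m : ℕ) :
    idealPerp I (d + m) →ₗ[ℂ] idealPerp I (d + m) :=
  compression (V := symSubspace ι (d + m)) (idealPerp I (d + m)) (liftForm H m)

end Operators

/-- As a form, `H_k` is `H(z, z^*) ‖z‖^{2(k-d)}`, where `k = d + m`. -/
theorem inner_liftForm {ι E : Type*} [Fintype ι] [NormedAddCommGroup E] [InnerProductSpace ℂ E]
    (b : OrthonormalBasis ι ℂ E) {d : ℕ} (H : symSubspace ι d →ₗ[ℂ] symSubspace ι d) (m : ℕ)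
    (z : E) :
    inner ℂ (vecPow b (d + m) z) (liftForm H m (vecPow b (d + m) z)) =
      inner ℂ (vecPow b d z) (H (vecPow b d z)) * ((‖z‖ ^ (2 * m) : ℝ) : ℂ) := by
  have hslice : ∀ u : Fin m → ι, sliceLast d m u (vecPow b (d + m) z : TensorPow ι (d + m)) =
      (∏ j, b.repr z (u j)) • (vecPow b d z : TensorPow ι d) := by
    intro u
    ext a
    change ∏ j, b.repr z (Fin.append a u j) = (∏ j, b.repr z (u j)) * ∏ j, b.repr z (a j)
    simp [Fin.prod_univ_add, mul_comm]
  have hnorm : ∑ u : Fin m → ι, (∏ j, b.repr z (u j)) * star (∏ j, b.repr z (u j)) =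
      ((‖z‖ ^ (2 * m) : ℝ) : ℂ) := by
    have h1 : ((‖z‖ ^ 2 : ℝ) : ℂ) = ∑ i, b.repr z i * star (b.repr z i) := by
      rw [← b.repr.norm_map z, EuclideanSpace.norm_sq_eq]
      push_cast
      refine Finset.sum_congr rfl fun i _ => ?_
      exact (RCLike.mul_conj _).symm
    rw [pow_mul]
    push_cast at h1 ⊢
    rw [h1, ← Fin.prod_const, Finset.prod_univ_sum]
    simp [Finset.prod_mul_distrib]
  have hL : inner ℂ (vecPow b (d + m) z) (liftForm H m (vecPow b (d + m) z)) =
      inner ℂ (vecPow b (d + m) z : TensorPow ι (d + m))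
        (tensorId (extendSym H) m (vecPow b (d + m) z : TensorPow ι (d + m))) := by
    simp only [liftForm, LinearMap.comp_apply, Submodule.subtype_apply,
      ContinuousLinearMap.coe_coe]
    exact Submodule.inner_orthogonalProjectionOnto_eq_of_mem_left _ _
  have hext : extendSym H (vecPow b d z : TensorPow ι d) = (H (vecPow b d z) : TensorPow ι d) := by
    simp [extendSym]
  rw [hL, Submodule.coe_inner, ← hnorm, PiLp.inner_apply, PiLp.inner_apply,
    ← (Fin.appendEquiv d m).sum_comp, Fintype.sum_prod_type, Finset.sum_mul]
  refine Finset.sum_congr rfl fun a _ => ?_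
  rw [Finset.mul_sum]
  refine Finset.sum_congr rfl fun u _ => ?_
  have hv : (vecPow b (d + m) z : TensorPow ι (d + m)) (Fin.append a u) =
      (vecPow b d z : TensorPow ι d) a * ∏ j, b.repr z (u j) := by
    change ∏ j, b.repr z (Fin.append a u j) = (∏ j, b.repr z (a j)) * ∏ j, b.repr z (u j)
    simp [Fin.prod_univ_add]
  have hA : tensorId (extendSym H) m (vecPow b (d + m) z : TensorPow ι (d + m)) (Fin.append a u) =
      (∏ j, b.repr z (u j)) * (H (vecPow b d z) : TensorPow ι d) a := by
    simp [tensorId, hslice, hext]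
  change inner ℂ ((vecPow b (d + m) z : TensorPow ι (d + m)) (Fin.append a u))
    (tensorId (extendSym H) m (vecPow b (d + m) z : TensorPow ι (d + m)) (Fin.append a u)) = _
  rw [hv, hA]
  simp only [RCLike.inner_apply, map_mul]
  simp
  ring

end HermitianHierarchy

/-! Fixing the last indices of a symmetric tensor, "slicing", carries the argument. The form of
`liftForm H m` at `v` is the sum of the forms of `H` over the slices of `v`
(`inner_liftForm_eq_sum`), and slices of tensors in `idealPerp` stay in `idealPerp`
(`sliceSym_mem_idealPerp`). A lower bound at one level therefore passes to all later ones, which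
gives monotonicity. Testing on `z^{⊗k}` with `z` in the zero set of `I` bounds every level above by
`H(z, z^*)`.

For the lower bound with `I = 0` (`eventually_le_inner_liftForm`), let `x` be an eigenvector of the
lifted form for its least eigenvalue `μ`, and let `u` maximise `|x(u, …, u)|` on the unit sphere.
Cauchy estimates in directions orthogonal to `u` show that contracting `x` with all but `D` copies
of `u` gives `p z^{⊗D}` up to relative error `O(1/√k)`, where `z` is the conjugate of `u` and `p =
x(u, …, u)`. Pairing the eigenvalue equation with `z^{⊗k}` then gives `μ ≈ A(z, z^*)`.

For general `I`, let `c` lie strictly below `H` on the zero set. By compactness a single level `d +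
m₀` already detects that no unit `z` with `H(z, z^*) ≤ c` is a zero
(`exists_forall_notMem_idealPerp`). A large multiple of the projection away from `idealPerp` at that
level lifts the form to at least `c` on the whole sphere. The unconstrained bound applies to this
penalised form, and on `idealPerp` the penalty disappears. -/

namespace HermitianHierarchy

/-! ### Least eigenvalues and quadratic form bounds -/

section Eigenvalues

variable {V : Type*} [NormedAddCommGroup V] [InnerProductSpace ℂ V]

theorem le_of_hasEigenvalue_of_forall_le_inner {T : V →ₗ[ℂ] V} {c : ℝ}
    (h : ∀ v, c * ‖v‖ ^ 2 ≤ (inner ℂ v (T v)).re) {μ : ℝ}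
    (hμ : Module.End.HasEigenvalue T (μ : ℂ)) : c ≤ μ := by
  obtain ⟨v, hv⟩ := hμ.exists_hasEigenvector
  have h1 := h v
  rw [hv.apply_eq_smul, inner_smul_right, inner_self_eq_norm_sq_to_K] at h1
  have h2 : ((μ : ℂ) * ((‖v‖ : ℝ) : ℂ) ^ 2).re = μ * ‖v‖ ^ 2 := by
    rw [← Complex.ofReal_pow, ← Complex.ofReal_mul, Complex.ofReal_re]
  have h3 : (0 : ℝ) < ‖v‖ ^ 2 := by
    have := norm_pos_iff.mpr hv.2
    positivity
  exact le_of_mul_le_mul_right (h1.trans_eq h2) h3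

theorem le_minEigenvalue_of_forall_le_inner {T : V →ₗ[ℂ] V} {c : ℝ}
    (h : ∀ v, c * ‖v‖ ^ 2 ≤ (inner ℂ v (T v)).re) : (c : EReal) ≤ minEigenvalue T := by
  refine le_iInf₂ fun μ hμ => ?_
  exact_mod_cast le_of_hasEigenvalue_of_forall_le_inner h hμ

theorem exists_eigenvalue_le_inner [FiniteDimensional ℂ V] [Nontrivial V] {T : V →ₗ[ℂ] V}
    (hT : T.IsSymmetric) :
    ∃ μ : ℝ, Module.End.HasEigenvalue T (μ : ℂ) ∧
      ∀ v, μ * ‖v‖ ^ 2 ≤ (inner ℂ v (T v)).re := by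
  refine ⟨_, hT.hasEigenvalue_iInf_of_finiteDimensional, fun v => ?_⟩
  by_cases hv : v = 0
  · simp [hv]
  have hpos : (0 : ℝ) < ‖v‖ ^ 2 := by
    have := norm_pos_iff.mpr hv
    positivity
  -- The real infimum of the Rayleigh quotient is informative only if the quotient is bounded below;
  -- the operator norm supplies the bound.
  have hbdd : BddBelow (Set.range fun x : { x : V // x ≠ 0 } =>
      RCLike.re (inner ℂ (T x) (x : V)) / ‖(x : V)‖ ^ 2) := by
    refine ⟨-‖LinearMap.toContinuousLinearMap T‖, ?_⟩
    rintro _ ⟨x, rfl⟩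
    exact (abs_le.mp ((LinearMap.toContinuousLinearMap T).rayleighQuotient_le_norm x)).1
  have h1 := ciInf_le hbdd ⟨v, hv⟩
  have h2 : RCLike.re (inner ℂ (T v) v) = (inner ℂ v (T v)).re := by
    rw [hT v v]; rfl
  simp only [h2] at h1
  exact (le_div_iff₀ hpos).mp h1

theorem exists_isLeast_eigenvalue [FiniteDimensional ℂ V] [Nontrivial V] {T : V →ₗ[ℂ] V}
    (hT : T.IsSymmetric) :
    ∃ ν : ℝ, minEigenvalue T = (ν : EReal) ∧
      IsLeast {μ : ℝ | Module.End.HasEigenvalue T (μ : ℂ)} ν ∧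
      ∀ v, ν * ‖v‖ ^ 2 ≤ (inner ℂ v (T v)).re := by
  obtain ⟨ν, hν, h⟩ := exists_eigenvalue_le_inner hT
  exact ⟨ν, le_antisymm (iInf₂_le ν hν) (le_minEigenvalue_of_forall_le_inner h),
    ⟨hν, fun μ hμ => le_of_hasEigenvalue_of_forall_le_inner h hμ⟩, h⟩

theorem inner_compression (K : Submodule ℂ V) [K.HasOrthogonalProjection] (T : V →ₗ[ℂ] V)
    (v w : K) : inner ℂ v (compression K T w) = inner ℂ (v : V) (T w) := by
  simp only [compression, LinearMap.comp_apply, Submodule.subtype_apply,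
    ContinuousLinearMap.coe_coe]
  exact Submodule.inner_orthogonalProjectionOnto_eq_of_mem_left _ _

theorem isSymmetric_compression (K : Submodule ℂ V) [K.HasOrthogonalProjection] {T : V →ₗ[ℂ] V}
    (hT : T.IsSymmetric) : (compression K T).IsSymmetric := by
  intro v w
  rw [inner_compression, ← inner_conj_symm, inner_compression, inner_conj_symm, hT]

end Eigenvalues

/-! ### Slices of symmetric tensors -/

section Slices

variable {ι : Type*}

/-- Fixing the last `m` indices of a symmetric tensor. -/
def sliceSym {k m : ℕ} (u : Fin m → ι) (v : symSubspace ι (k + m)) : symSubspace ι k :=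
  ⟨WithLp.toLp 2 fun a => (v : TensorPow ι (k + m)) (Fin.append a u), by
    intro σ a
    have h := v.2 (finSumFinEquiv.symm.trans
      ((Equiv.sumCongr σ (Equiv.refl (Fin m))).trans finSumFinEquiv)) (Fin.append a u)
    rw [← h]
    refine congrArg (v : TensorPow ι (k + m)) (funext fun j => ?_)
    refine Fin.addCases (fun j => ?_) (fun j => ?_) j <;> simp⟩

theorem sliceSym_apply {k m : ℕ} (u : Fin m → ι) (v : symSubspace ι (k + m)) (a : Fin k → ι) :
    (sliceSym u v : TensorPow ι k) a = (v : TensorPow ι (k + m)) (Fin.append a u) := rfl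

/-- Reindexing a symmetric tensor along an equality of degrees. -/
def castSym {n n' : ℕ} (h : n = n') (v : symSubspace ι n) : symSubspace ι n' :=
  h ▸ v

theorem castSym_apply {n n' : ℕ} (h : n = n') (v : symSubspace ι n) (w : Fin n' → ι) :
    (castSym h v : TensorPow ι n') w = (v : TensorPow ι n) (w ∘ Fin.cast h) := by
  subst h
  rfl

theorem sliceSym_sliceSym_castSym {d m₀ m : ℕ} (u₀ : Fin m₀ → ι) (u : Fin m → ι)
    (v : symSubspace ι (d + (m₀ + m))) :
    sliceSym u₀ (sliceSym u (castSym (Nat.add_assoc d m₀ m).symm v)) =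
      sliceSym (Fin.append u₀ u) v := by
  ext a
  rw [sliceSym_apply, sliceSym_apply, sliceSym_apply, castSym_apply, Fin.append_assoc]
  congr 1

variable [Fintype ι]

theorem norm_castSym {n n' : ℕ} (h : n = n') (v : symSubspace ι n) :
    ‖castSym h v‖ = ‖v‖ := by
  subst h
  rfl

theorem castSym_mem_idealPerp {n n' : ℕ} (h : n = n') {I : Ideal (MvPolynomial ι ℂ)}
    {v : symSubspace ι n} (hv : v ∈ idealPerp I n) : castSym h v ∈ idealPerp I n' := by
  subst h
  exact hv

theorem inner_eq_sum_sliceSym {k m : ℕ} (v w : symSubspace ι (k + m)) :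
    inner ℂ v w = ∑ u : Fin m → ι, inner ℂ (sliceSym u v) (sliceSym u w) := by
  rw [Submodule.coe_inner, PiLp.inner_apply, ← (Fin.appendEquiv k m).sum_comp,
    Fintype.sum_prod_type_right]
  refine Finset.sum_congr rfl fun u _ => ?_
  rw [Submodule.coe_inner, PiLp.inner_apply]
  rfl

theorem norm_sq_eq_sum_sliceSym {k m : ℕ} (v : symSubspace ι (k + m)) :
    ‖v‖ ^ 2 = ∑ u : Fin m → ι, ‖sliceSym u v‖ ^ 2 := by
  have h := ((inner_self_eq_norm_sq_to_K (𝕜 := ℂ) v).symm.trans (inner_eq_sum_sliceSym v v)).trans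
    (Finset.sum_congr rfl fun u _ => inner_self_eq_norm_sq_to_K (𝕜 := ℂ) (sliceSym u v))
  exact_mod_cast h

theorem inner_liftForm_eq_sum {d m : ℕ} (A : symSubspace ι d →ₗ[ℂ] symSubspace ι d)
    (v w : symSubspace ι (d + m)) :
    inner ℂ v (liftForm A m w) = ∑ u : Fin m → ι, inner ℂ (sliceSym u v) (A (sliceSym u w)) := by
  have hL : inner ℂ v (liftForm A m w) = inner ℂ (v : TensorPow ι (d + m))
      (tensorId (extendSym A) m (w : TensorPow ι (d + m))) := by
    simp only [liftForm, LinearMap.comp_apply, Submodule.subtype_apply,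
      ContinuousLinearMap.coe_coe]
    exact Submodule.inner_orthogonalProjectionOnto_eq_of_mem_left _ _
  rw [hL, PiLp.inner_apply, ← (Fin.appendEquiv d m).sum_comp, Fintype.sum_prod_type_right]
  refine Finset.sum_congr rfl fun u _ => ?_
  rw [Submodule.coe_inner, PiLp.inner_apply]
  refine Finset.sum_congr rfl fun a _ => ?_
  have hs : sliceLast d m u (w : TensorPow ι (d + m)) = (sliceSym u w : TensorPow ι d) := rfl
  have hA : tensorId (extendSym A) m (w : TensorPow ι (d + m)) (Fin.append a u) =
      (A (sliceSym u w) : TensorPow ι d) a := by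
    simp [tensorId, hs, extendSym]
  change inner ℂ ((v : TensorPow ι (d + m)) (Fin.append a u))
    (tensorId (extendSym A) m (w : TensorPow ι (d + m)) (Fin.append a u)) = _
  rw [hA]
  rfl

theorem isSymmetric_liftForm {d : ℕ} {A : symSubspace ι d →ₗ[ℂ] symSubspace ι d}
    (hA : LinearMap.IsSymmetric (𝕜 := ℂ) (E := symSubspace ι d) A) (m : ℕ) :
    LinearMap.IsSymmetric (𝕜 := ℂ) (E := symSubspace ι (d + m)) (liftForm A m) := by
  intro v w
  rw [← inner_conj_symm, inner_liftForm_eq_sum, inner_liftForm_eq_sum, map_sum]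
  exact Finset.sum_congr rfl fun u _ =>
    (inner_conj_symm (𝕜 := ℂ) (A (sliceSym u v)) (sliceSym u w)).trans (hA _ _)

/-- Lifting is transitive: tensoring with `m₀ + m` identities can be done in two stages. The cast
reconciles `d + (m₀ + m)` with `(d + m₀) + m`. -/
theorem inner_liftForm_castSym {d m₀ m : ℕ} (A : symSubspace ι d →ₗ[ℂ] symSubspace ι d)
    (v : symSubspace ι (d + (m₀ + m))) :
    inner ℂ v (liftForm A (m₀ + m) v) =
      ∑ u : Fin m → ι, inner ℂ (sliceSym u (castSym (Nat.add_assoc d m₀ m).symm v))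
        (liftForm A m₀ (sliceSym u (castSym (Nat.add_assoc d m₀ m).symm v))) := by
  simp only [inner_liftForm_eq_sum, sliceSym_sliceSym_castSym]
  rw [← (Fin.appendEquiv m₀ m).sum_comp, Fintype.sum_prod_type_right]
  rfl

end Slices

/-! ### Tensors, polynomials and the annihilator of the ideal -/

section Ideals

variable {ι : Type*} [Fintype ι]

/-- The sum of all permutations of a tensor. -/
noncomputable def symmetrize {k : ℕ} (T : TensorPow ι k) : symSubspace ι k :=
  ⟨WithLp.toLp 2 fun w => ∑ σ : Equiv.Perm (Fin k), T (w ∘ σ), by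
    intro τ w
    exact Fintype.sum_equiv (Equiv.mulLeft τ) _ _ fun σ => rfl⟩

theorem sum_symmetrize_mul {k : ℕ} {R : Type*} [CommSemiring R] [Module ℂ R] (T : TensorPow ι k)
    (g : (Fin k → ι) → R) (hg : ∀ (σ : Equiv.Perm (Fin k)) w, g (w ∘ σ) = g w) :
    ∑ w, (symmetrize T : TensorPow ι k) w • g w = k.factorial • ∑ w, T w • g w := by
  have h : ∀ σ : Equiv.Perm (Fin k), ∑ w, T (w ∘ σ) • g w = ∑ w, T w • g w := by
    intro σ
    rw [← (Equiv.arrowCongr σ (Equiv.refl ι)).sum_comp]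
    refine Finset.sum_congr rfl fun w _ => ?_
    have : (Equiv.arrowCongr σ (Equiv.refl ι)) w ∘ σ = w := by
      funext j; simp [Equiv.arrowCongr]
    rw [this, ← hg σ ((Equiv.arrowCongr σ (Equiv.refl ι)) w), this]
  change ∑ w, (∑ σ : Equiv.Perm (Fin k), T (w ∘ σ)) • g w = _
  simp only [Finset.sum_smul]
  rw [Finset.sum_comm]
  simp [h, Fintype.card_perm]

theorem tensorPoly_eq_sum_smul {k : ℕ} (T : TensorPow ι k) :
    tensorPoly T = ∑ w : Fin k → ι, T w • ∏ j, (MvPolynomial.X (w j) : MvPolynomial ι ℂ) := by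
  simp [tensorPoly, MvPolynomial.smul_eq_C_mul]

theorem tensorPoly_symmetrize {k : ℕ} (T : TensorPow ι k) :
    tensorPoly (symmetrize T : TensorPow ι k) = k.factorial • tensorPoly T := by
  rw [tensorPoly_eq_sum_smul, tensorPoly_eq_sum_smul]
  exact sum_symmetrize_mul T _ fun σ w =>
    Equiv.prod_comp σ fun j => (MvPolynomial.X (w j) : MvPolynomial ι ℂ)

/-- Symmetrizing `T` multiplies both its polynomial and its pairing with the symmetric `v` by `k!`,
so symmetry of the test tensor is immaterial. This permits test tensors such as `T ⊗ e_u`. -/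
theorem mem_idealPerp_iff {I : Ideal (MvPolynomial ι ℂ)} {k : ℕ} {v : symSubspace ι k} :
    v ∈ idealPerp I k ↔ ∀ T : TensorPow ι k, tensorPoly T ∈ I →
      ∑ w : Fin k → ι, T w * (v : TensorPow ι k) w = 0 := by
  refine ⟨fun hv T hT => ?_, fun hv T _ hI => hv T hI⟩
  have h := hv (symmetrize T) (symmetrize T).2 (by
    rw [tensorPoly_symmetrize]
    exact nsmul_mem hT _)
  have h' := sum_symmetrize_mul T (fun w => (v : TensorPow ι k) w) v.2
  simp only [smul_eq_mul] at h'
  rw [h, eq_comm, smul_eq_zero] at h'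
  exact h'.resolve_left (Nat.factorial_ne_zero k)

/-- Pairing `T` with the slice is pairing `T ⊗ e_u` with `v`, and the polynomial of `T ⊗ e_u` is
that of `T` times a monomial, hence still in `I`. -/
theorem sliceSym_mem_idealPerp {I : Ideal (MvPolynomial ι ℂ)} {k m : ℕ} (u : Fin m → ι)
    {v : symSubspace ι (k + m)} (hv : v ∈ idealPerp I (k + m)) :
    sliceSym u v ∈ idealPerp I k := by
  classical
  rw [mem_idealPerp_iff] at hv ⊢
  intro T hT
  let T' : TensorPow ι (k + m) := WithLp.toLp 2 fun w =>
    if (fun j => w (Fin.natAdd k j)) = u then T (fun i => w (Fin.castAdd m i)) else 0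
  have hT' : ∀ a u', T' (Fin.append a u') = if u' = u then T a else 0 := by
    intro a u'
    simp [T']
  have h1 : tensorPoly T' = tensorPoly T * ∏ j, MvPolynomial.X (u j) := by
    unfold tensorPoly
    rw [← (Fin.appendEquiv k m).sum_comp, Fintype.sum_prod_type, Finset.sum_mul]
    refine Finset.sum_congr rfl fun a _ => ?_
    change ∑ u', MvPolynomial.C (T' (Fin.append a u')) *
      ∏ j, MvPolynomial.X (Fin.append a u' j) = _
    simp only [hT']
    rw [Finset.sum_eq_single u]
    · simp [Fin.prod_univ_add, mul_assoc]
    · intro u' _ hu'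
      simp [hu']
    · simp
  have h2 := hv T' (h1 ▸ I.mul_mem_right _ hT)
  rw [← (Fin.appendEquiv k m).sum_comp, Fintype.sum_prod_type] at h2
  rw [← h2]
  refine Finset.sum_congr rfl fun a _ => ?_
  change _ = ∑ u', T' (Fin.append a u') * (v : TensorPow ι (k + m)) (Fin.append a u')
  simp [hT', sliceSym_apply]

theorem eval_tensorPoly {k : ℕ} (T : TensorPow ι k) (y : ι → ℂ) :
    MvPolynomial.eval y (tensorPoly T) = ∑ w : Fin k → ι, T w * ∏ j, y (w j) := by
  simp [tensorPoly]

/-- By linearity a monomial suffices: listing its variables with multiplicity gives a word of length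
`k`, and the tensor is supported on that word. -/
theorem exists_tensorPoly_eq {k : ℕ} {f : MvPolynomial ι ℂ} (hf : f.IsHomogeneous k) :
    ∃ T : TensorPow ι k, tensorPoly T = f := by
  classical
  let L : TensorPow ι k →ₗ[ℂ] MvPolynomial ι ℂ :=
    { toFun := tensorPoly
      map_add' := fun S T => by
        simp [tensorPoly_eq_sum_smul, add_smul, Finset.sum_add_distrib]
      map_smul' := fun c T => by
        simp [tensorPoly_eq_sum_smul, Finset.smul_sum, smul_smul] }
  change f ∈ LinearMap.range L
  rw [f.as_sum]
  refine Submodule.sum_mem _ fun α hα => ?_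
  have hdeg : α.degree = k := by
    have := hf (MvPolynomial.mem_support_iff.mp hα)
    rw [Finsupp.degree_eq_weight_one]
    exact this
  have hcard : α.toMultiset.card = k := by
    rw [← hdeg, Finsupp.card_toMultiset]
    rfl
  obtain ⟨l, hl⟩ := Quot.exists_rep α.toMultiset
  have hlen : l.length = k := by
    rw [← hcard, ← hl]
    rfl
  subst hlen
  have hprod : ∏ j, (MvPolynomial.X (l.get j) : MvPolynomial ι ℂ) =
      α.prod fun i e => MvPolynomial.X i ^ e := by
    have h1 : (α.toMultiset.map (MvPolynomial.X : ι → MvPolynomial ι ℂ)).prod =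
        α.prod fun i e => MvPolynomial.X i ^ e := by
      rw [Finsupp.toMultiset_map, Finsupp.prod_toMultiset,
        Finsupp.prod_mapDomain_index (by simp) (by simp [pow_add])]
    rw [← h1, ← hl]
    simp
  refine ⟨EuclideanSpace.single l.get (MvPolynomial.coeff α f), ?_⟩
  change tensorPoly _ = _
  rw [MvPolynomial.monomial_eq, ← hprod]
  unfold tensorPoly
  rw [Finset.sum_eq_single l.get]
  · simp
  · intro w _ hw
    simp [hw]
  · simp

end Ideals

/-! ### Symmetric multilinear forms and Cauchy estimates near a maximiser -/

section Contraction

variable {ι : Type*} [Fintype ι]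

/-- The value of a symmetric tensor, as a multilinear form, on `k` vectors. -/
def contract {k : ℕ} (v : symSubspace ι k) (y : Fin k → ι → ℂ) : ℂ :=
  ∑ w : Fin k → ι, (v : TensorPow ι k) w * ∏ j, y j (w j)

theorem contract_comp_perm {k : ℕ} (v : symSubspace ι k) (y : Fin k → ι → ℂ)
    (σ : Equiv.Perm (Fin k)) : contract v (y ∘ σ) = contract v y := by
  unfold contract
  rw [← (Equiv.arrowCongr σ (Equiv.refl ι)).sum_comp
    (fun w : Fin k → ι => (v : TensorPow ι k) w * ∏ j, y j (w j))]
  refine Finset.sum_congr rfl fun w _ => ?_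
  have h : (Equiv.arrowCongr σ (Equiv.refl ι)) w ∘ σ = w := by
    funext j; simp [Equiv.arrowCongr]
  rw [← v.2 σ ((Equiv.arrowCongr σ (Equiv.refl ι)) w), h,
    ← Equiv.prod_comp σ (fun j => y j ((Equiv.arrowCongr σ (Equiv.refl ι)) w j))]
  congr 1
  refine Finset.prod_congr rfl fun j _ => ?_
  rw [← Function.comp_apply (f := (Equiv.arrowCongr σ (Equiv.refl ι)) w), h]
  rfl

/-- A bijection `s ≃ s'` extends to a permutation of the slots, under which the contraction is
invariant. -/
theorem contract_piecewise_eq_of_card_eq {k : ℕ} (v : symSubspace ι k) (w u : ι → ℂ)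
    {s s' : Finset (Fin k)} (h : s.card = s'.card) :
    contract v (s.piecewise (fun _ => w) fun _ => u) =
      contract v (s'.piecewise (fun _ => w) fun _ => u) := by
  classical
  let e : {x // x ∈ s} ≃ {x // x ∈ s'} := Fintype.equivOfCardEq (by simpa using h)
  rw [← contract_comp_perm v (s'.piecewise _ _) e.extendSubtype]
  congr 1
  funext j
  by_cases hj : j ∈ s
  · simp [Finset.piecewise, hj, e.extendSubtype_mem j hj]
  · have := e.extendSubtype_not_mem j hj
    simp [Finset.piecewise, hj, this]

theorem contract_add_smul {k : ℕ} (v : symSubspace ι k) (u w : ι → ℂ) (α t : ℂ) :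
    contract v (fun _ => α • u + t • w) =
      ∑ s : Finset (Fin k), t ^ s.card * α ^ (k - s.card) *
        contract v (s.piecewise (fun _ => w) fun _ => u) := by
  classical
  simp only [contract, Finset.mul_sum]
  rw [Finset.sum_comm]
  refine Finset.sum_congr rfl fun a _ => ?_
  have h := Finset.prod_add (fun j => t * w (a j)) (fun j => α * u (a j)) Finset.univ
  have h0 : ∏ j, (α • u + t • w) (a j) = ∏ j, (t * w (a j) + α * u (a j)) := by
    simp [add_comm]
  rw [h0, h, Finset.mul_sum, Finset.powerset_univ]
  refine Finset.sum_congr rfl fun s _ => ?_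
  have h1 : ∏ j, (s.piecewise (fun _ => w) fun _ => u : Fin k → ι → ℂ) j (a j) =
      (∏ j ∈ s, w (a j)) * ∏ j ∈ Finset.univ \ s, u (a j) := by
    rw [← Finset.prod_sdiff (Finset.subset_univ s), mul_comm]
    congr 1
    · exact Finset.prod_congr rfl fun j hj => by simp [Finset.piecewise, hj]
    · refine Finset.prod_congr rfl fun j hj => ?_
      simp [Finset.piecewise, (Finset.mem_sdiff.mp hj).2]
  rw [h1, Finset.prod_mul_distrib, Finset.prod_mul_distrib, Finset.prod_const, Finset.prod_const,
    Finset.card_sdiff_of_subset (Finset.subset_univ s), Finset.card_univ, Fintype.card_fin]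
  ring

theorem _root_.Polynomial.norm_coeff_mul_pow_le (Q : Polynomial ℂ) {r M : ℝ} (hr : 0 < r)
    (hM : ∀ t : ℂ, ‖t‖ = r → ‖Q.eval t‖ ≤ M) (n : ℕ) : ‖Q.coeff n‖ * r ^ n ≤ M := by
  have h := Complex.norm_iteratedDeriv_le_of_forall_mem_sphere_norm_le (c := 0)
    (f := fun t => Q.eval t) (C := M) n hr Q.differentiable.diffContOnCl (fun t ht => hM t (by simpa using ht))
  have h2 : iteratedDeriv n (fun t => Q.eval t) 0 = (n.factorial : ℂ) * Q.coeff n := by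
    have h3 : ∀ n : ℕ, iteratedDeriv n (fun t => Q.eval t) =
        fun t => (Polynomial.derivative^[n] Q).eval t := by
      intro n
      induction n with
      | zero => simp
      | succ n ih =>
        rw [iteratedDeriv_succ, ih]
        funext t
        rw [Polynomial.deriv, Function.iterate_succ_apply']
    rw [h3]
    simp only
    rw [← Polynomial.coeff_zero_eq_eval_zero, Polynomial.coeff_iterate_derivative]
    simp [Nat.descFactorial_self]
  rw [h2, norm_mul, Complex.norm_natCast, mul_div_assoc] at h
  have h4 : (0 : ℝ) < n.factorial := by exact_mod_cast n.factorial_pos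
  exact (le_div_iff₀ (pow_pos hr n)).mp (le_of_mul_le_mul_left h h4)

/-- Cauchy's estimate for the polynomial `t ↦ v(u + t w, …, u + t w)`: by symmetry, all `k.choose j`
ways of placing `w` in `j` slots contribute equally to the coefficient of `t ^ j`. -/
theorem choose_mul_norm_contract_piecewise_le {k : ℕ} (v : symSubspace ι k) (u w : ι → ℂ)
    {r M : ℝ} (hr : 0 < r) (hM : ∀ t : ℂ, ‖t‖ = r → ‖contract v (fun _ => u + t • w)‖ ≤ M)
    (s : Finset (Fin k)) :
    k.choose s.card * ‖contract v (s.piecewise (fun _ => w) fun _ => u)‖ * r ^ s.card ≤ M := by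
  classical
  let Q : Polynomial ℂ := ∑ s : Finset (Fin k),
    Polynomial.C (contract v (s.piecewise (fun _ => w) fun _ => u)) * Polynomial.X ^ s.card
  have hQ : ∀ t, Q.eval t = contract v (fun _ => u + t • w) := by
    intro t
    have := contract_add_smul v u w 1 t
    simp only [one_smul, one_pow, mul_one] at this
    rw [this]
    simp only [Q, Polynomial.eval_finsetSum, Polynomial.eval_mul, Polynomial.eval_C,
      Polynomial.eval_pow, Polynomial.eval_X]
    exact Finset.sum_congr rfl fun s _ => mul_comm _ _
  have hc : Q.coeff s.card = k.choose s.card *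
      contract v (s.piecewise (fun _ => w) fun _ => u) := by
    simp only [Q, Polynomial.finsetSum_coeff, Polynomial.coeff_C_mul, Polynomial.coeff_X_pow,
      mul_ite, mul_one, mul_zero]
    rw [← Finset.sum_filter, Finset.sum_congr rfl
      (g := fun _ => contract v (s.piecewise (fun _ => w) fun _ => u)), Finset.sum_const]
    · rw [show (Finset.univ.filter fun a : Finset (Fin k) => s.card = a.card) =
        Finset.powersetCard s.card Finset.univ by ext a; simp [eq_comm],
        Finset.card_powersetCard, Finset.card_univ, Fintype.card_fin, nsmul_eq_mul]
    · intro a ha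
      exact contract_piecewise_eq_of_card_eq v w u (Finset.mem_filter.mp ha).2.symm
  have h := Q.norm_coeff_mul_pow_le hr (fun t ht => (hQ t).symm ▸ hM t ht) s.card
  rwa [hc, norm_mul, Complex.norm_natCast] at h

theorem contract_sliceSym {k m : ℕ} (v : symSubspace ι (k + m)) (y : Fin k → ι → ℂ)
    (u : Fin m → ι → ℂ) :
    contract v (Fin.append y u) =
      ∑ t : Fin m → ι, (∏ j, u j (t j)) * contract (sliceSym t v) y := by
  unfold contract
  rw [← (Fin.appendEquiv k m).sum_comp, Fintype.sum_prod_type_right]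
  refine Finset.sum_congr rfl fun t _ => ?_
  rw [Finset.mul_sum]
  refine Finset.sum_congr rfl fun a _ => ?_
  change (v : TensorPow ι (k + m)) (Fin.append a t) *
    ∏ j, (Fin.append y u) j (Fin.append a t j) = _
  rw [Fin.prod_univ_add, sliceSym_apply]
  simp only [Fin.append_left, Fin.append_right]
  ring

/-- Polarisation by induction: the coefficient of `t` in `v(z + t e_i, …)` is a multiple of the
slice of `v` at `i` evaluated on the diagonal, so every slice vanishes. -/
theorem eq_zero_of_contract_eq_zero {k : ℕ} {v : symSubspace ι k}
    (h : ∀ z : ι → ℂ, contract v (fun _ => z) = 0) : v = 0 := by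
  classical
  induction k with
  | zero =>
    ext a
    have := h 0
    simp only [contract, Finset.univ_eq_empty, Finset.prod_empty, mul_one,
      Fintype.sum_unique] at this
    rw [Subsingleton.elim a default]
    simpa using this
  | succ k ih =>
    have hs : ∀ i : Fin 1 → ι, sliceSym i v = 0 := by
      intro i
      refine ih fun z => ?_
      have h1 := choose_mul_norm_contract_piecewise_le v z (Pi.single (i 0) 1) one_pos
        (M := 0) (fun t _ => by simp [h]) {Fin.last k}
      have h2 : contract v (({Fin.last k} : Finset (Fin (k + 1))).piecewise
          (fun _ => Pi.single (i 0) 1) fun _ => z) = 0 := by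
        simp only [Finset.card_singleton, Nat.choose_one_right, one_pow, mul_one] at h1
        have h3 : (0 : ℝ) < ((k + 1 : ℕ) : ℝ) := by positivity
        exact norm_le_zero_iff.mp (nonpos_of_mul_nonpos_right h1 h3)
      have h4 : (({Fin.last k} : Finset (Fin (k + 1))).piecewise
          (fun _ => Pi.single (i 0) 1) fun _ => z : Fin (k + 1) → ι → ℂ) =
          Fin.append (fun _ : Fin k => z) (fun _ : Fin 1 => Pi.single (i 0) 1) := by
        funext j
        refine Fin.addCases (fun j => ?_) (fun j => ?_) j
        · rw [Fin.append_left]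
          simp only [Finset.piecewise, Finset.mem_singleton]
          rw [if_neg]
          exact (Fin.castSucc_lt_last j).ne
        · rw [Fin.append_right]
          simp only [Finset.piecewise, Finset.mem_singleton]
          rw [if_pos]
          ext; simp
      rw [h4, contract_sliceSym, Finset.sum_eq_single i] at h2
      · simpa using h2
      · intro t _ ht
        have : t 0 ≠ i 0 := fun h => ht (funext fun j => by rw [Subsingleton.elim j 0, h])
        simp [this]
      · simp
    ext a
    have h5 : a = Fin.append (fun j : Fin k => a (Fin.castAdd 1 j))
        (fun j : Fin 1 => a (Fin.natAdd k j)) := (Fin.append_castAdd_natAdd).symm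
    have h6 := sliceSym_apply (fun j : Fin 1 => a (Fin.natAdd k j)) v
      (fun j : Fin k => a (Fin.castAdd 1 j))
    rw [hs] at h6
    rw [h5, ← h6]
    rfl

theorem contract_sub {k : ℕ} (v w : symSubspace ι k) (y : Fin k → ι → ℂ) :
    contract (v - w) y = contract v y - contract w y := by
  simp [contract, sub_mul]

theorem contract_add {k : ℕ} (v w : symSubspace ι k) (y : Fin k → ι → ℂ) :
    contract (v + w) y = contract v y + contract w y := by
  simp [contract, add_mul, Finset.sum_add_distrib]

theorem contract_smul {k : ℕ} (c : ℂ) (v : symSubspace ι k) (y : Fin k → ι → ℂ) :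
    contract (c • v) y = c * contract v y := by
  simp [contract, mul_assoc, Finset.mul_sum]

theorem contract_sum {k : ℕ} {κ : Type*} (s : Finset κ) (v : κ → symSubspace ι k)
    (y : Fin k → ι → ℂ) : contract (∑ i ∈ s, v i) y = ∑ i ∈ s, contract (v i) y := by
  classical
  induction s using Finset.induction_on with
  | empty => simp [contract]
  | insert i s hi ih => rw [Finset.sum_insert hi, Finset.sum_insert hi, contract_add, ih]

theorem contract_const_smul {k : ℕ} (v : symSubspace ι k) (c : ℂ) (z : ι → ℂ) :
    contract v (fun _ => c • z) = c ^ k * contract v (fun _ => z) := by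
  simp only [contract, Pi.smul_apply, smul_eq_mul, Finset.prod_mul_distrib, Finset.prod_const,
    Finset.card_univ, Fintype.card_fin, Finset.mul_sum]
  exact Finset.sum_congr rfl fun w _ => by ring

theorem continuous_contract {k : ℕ} (v : symSubspace ι k) :
    Continuous fun z : EuclideanSpace ℂ ι => contract v (fun _ => z.ofLp) := by
  unfold contract
  fun_prop

/-- The contraction of the last `m` factors with the `m`-th power of a vector. -/
def contractPow {k m : ℕ} (v : symSubspace ι (k + m)) (u : ι → ℂ) : symSubspace ι k :=
  ∑ t : Fin m → ι, (∏ j, u (t j)) • sliceSym t v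

theorem contract_contractPow {k m : ℕ} (v : symSubspace ι (k + m)) (u : ι → ℂ)
    (y : Fin k → ι → ℂ) :
    contract (contractPow v u) y = contract v (Fin.append y fun _ => u) := by
  rw [contract_sliceSym, contractPow, contract_sum]
  simp only [contract_smul]

theorem exists_forall_norm_contract_le {k : ℕ} (hk : k ≠ 0) {v : symSubspace ι k} (hv : v ≠ 0) :
    ∃ u : EuclideanSpace ℂ ι, ‖u‖ = 1 ∧ contract v (fun _ => u.ofLp) ≠ 0 ∧
      ∀ z : EuclideanSpace ℂ ι, ‖contract v (fun _ => z.ofLp)‖ ≤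
        ‖contract v (fun _ => u.ofLp)‖ * ‖z‖ ^ k := by
  obtain ⟨z₀, hz₀⟩ : ∃ z₀ : ι → ℂ, contract v (fun _ => z₀) ≠ 0 := by
    by_contra! h
    exact hv (eq_zero_of_contract_eq_zero h)
  have hscale : ∀ z : EuclideanSpace ℂ ι, z ≠ 0 → contract v (fun _ => z.ofLp) =
      (‖z‖ : ℂ) ^ k * contract v (fun _ => (((‖z‖ : ℂ)⁻¹ • z : EuclideanSpace ℂ ι)).ofLp) := by
    intro z hz
    rw [← contract_const_smul, ← WithLp.ofLp_smul, smul_smul, mul_inv_cancel₀, one_smul]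
    exact_mod_cast norm_ne_zero_iff.mpr hz
  have hunit : ∀ z : EuclideanSpace ℂ ι, z ≠ 0 →
      ((‖z‖ : ℂ)⁻¹ • z) ∈ Metric.sphere (0 : EuclideanSpace ℂ ι) 1 := by
    intro z hz
    simp [norm_smul, norm_ne_zero_iff.mpr hz]
  have hzero : contract v (fun _ => (0 : EuclideanSpace ℂ ι).ofLp) = 0 := by
    have := contract_const_smul v 0 (0 : ι → ℂ)
    simpa [hk] using this
  -- This is where positive degree matters: it makes the contraction vanish at `0`, so `z₀ ≠ 0` and
  -- the unit sphere is nonempty.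
  have hne : (WithLp.toLp 2 z₀ : EuclideanSpace ℂ ι) ≠ 0 := by
    intro h
    apply hz₀
    rw [← hzero, ← h]
  obtain ⟨u, hu, hmax⟩ := (isCompact_sphere (0 : EuclideanSpace ℂ ι) 1).exists_isMaxOn
    ⟨_, hunit _ hne⟩ (continuous_contract v).norm.continuousOn
  have hle : ∀ z : EuclideanSpace ℂ ι, ‖contract v (fun _ => z.ofLp)‖ ≤
        ‖contract v (fun _ => u.ofLp)‖ * ‖z‖ ^ k := by
    intro z
    by_cases hz : z = 0
    · rw [hz, hzero, norm_zero]
      positivity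
    · rw [hscale z hz, norm_mul, norm_pow, Complex.norm_real, norm_norm, mul_comm]
      exact mul_le_mul_of_nonneg_right (hmax (hunit z hz)) (by positivity)
  refine ⟨u, by simpa using hu, fun h => ?_, hle⟩
  have := hle (WithLp.toLp 2 z₀)
  rw [h, norm_zero, zero_mul] at this
  exact hz₀ (norm_le_zero_iff.mp this)

/-- Restriction of diagonal values to the sphere is linear, injective by polarisation and
homogeneity, and has finite-dimensional domain, hence is antilipschitz. The constant depends only on
`D`, not on the level `k`. -/
theorem exists_norm_le_of_norm_contract_le [Nonempty ι] (D : ℕ) :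
    ∃ K : ℝ, 0 ≤ K ∧ ∀ (Y : symSubspace ι D) (M : ℝ), 0 ≤ M →
      (∀ z : EuclideanSpace ℂ ι, ‖z‖ = 1 → ‖contract Y (fun _ => z.ofLp)‖ ≤ M) →
      ‖Y‖ ≤ K * M := by
  let S := Metric.sphere (0 : EuclideanSpace ℂ ι) 1
  let L : symSubspace ι D →ₗ[ℂ] C(S, ℂ) :=
    { toFun := fun Y => ⟨fun z => contract Y (fun _ => z.1.ofLp),
        (continuous_contract Y).comp continuous_subtype_val⟩
      map_add' := fun Y Z => by ext z; exact contract_add Y Z _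
      map_smul' := fun c Y => by ext z; exact contract_smul c Y _ }
  have hL : LinearMap.ker L = ⊥ := by
    rw [LinearMap.ker_eq_bot']
    intro Y hY
    have h1 : ∀ z : EuclideanSpace ℂ ι, ‖z‖ = 1 → contract Y (fun _ => z.ofLp) = 0 := fun z hz =>
      congrArg (fun f : C(S, ℂ) => f ⟨z, by simp [S, hz]⟩) hY
    refine eq_zero_of_contract_eq_zero fun z => ?_
    obtain ⟨c, u, hu, hz⟩ : ∃ (c : ℂ) (u : EuclideanSpace ℂ ι), ‖u‖ = 1 ∧ z = c • u.ofLp := by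
      by_cases h0 : (WithLp.toLp 2 z : EuclideanSpace ℂ ι) = 0
      · obtain ⟨u, hu⟩ := exists_norm_eq (EuclideanSpace ℂ ι) zero_le_one
        refine ⟨0, u, hu, ?_⟩
        rw [zero_smul]
        exact congrArg WithLp.ofLp h0
      · refine ⟨‖(WithLp.toLp 2 z : EuclideanSpace ℂ ι)‖,
          (‖(WithLp.toLp 2 z : EuclideanSpace ℂ ι)‖ : ℂ)⁻¹ • WithLp.toLp 2 z, ?_, ?_⟩
        · simp [norm_smul, norm_ne_zero_iff.mpr h0]
        · rw [WithLp.ofLp_smul, smul_smul, mul_inv_cancel₀, one_smul]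
          exact_mod_cast norm_ne_zero_iff.mpr h0
    rw [hz, contract_const_smul, h1 u hu, mul_zero]
  obtain ⟨K, -, hK⟩ := L.exists_antilipschitzWith hL
  refine ⟨K, K.2, fun Y M hM hY => ?_⟩
  have h := hK.le_mul_dist Y 0
  rw [map_zero, dist_zero_right, dist_zero_right] at h
  refine h.trans (mul_le_mul_of_nonneg_left ?_ K.2)
  exact (ContinuousMap.norm_le _ hM).mpr fun z => hY z (by simp [S])

theorem pow_le_choose_mul {k j : ℕ} (h : 2 * j ≤ k) :
    (k : ℝ) ^ j ≤ 2 ^ j * j.factorial * k.choose j := by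
  have h1 := Nat.pow_le_choose (α := ℝ) j k
  have h2 : (0 : ℝ) < j.factorial := by exact_mod_cast j.factorial_pos
  rw [div_le_iff₀ h2] at h1
  have h3 : (k : ℝ) ≤ 2 * ((k + 1 - j : ℕ) : ℝ) := by
    have : k ≤ 2 * (k + 1 - j) := by omega
    exact_mod_cast this
  calc (k : ℝ) ^ j ≤ (2 * ((k + 1 - j : ℕ) : ℝ)) ^ j := by gcongr
    _ = 2 ^ j * ((k + 1 - j : ℕ) : ℝ) ^ j := mul_pow _ _ _
    _ ≤ 2 ^ j * (k.choose j * j.factorial) := by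
      gcongr
    _ = _ := by ring

/-- On the circle `|t| = 1/√k`, orthogonality gives `‖u + t w‖ ^ k ≤ (1 + 1/k) ^ (k/2)`, which stays
bounded. Cauchy's estimate divides by `k.choose j`, of order `k ^ j`, and loses only `k ^ (j/2)`,
leaving a gain of `k ^ (-j/2)`, at least `1/√k` since `j ≥ 1`. -/
theorem norm_contract_piecewise_le_of_isMax {k D : ℕ} (hk : 1 ≤ k) (hD : 2 * D ≤ k)
    {v : symSubspace ι k} {u w : EuclideanSpace ℂ ι} (hu : ‖u‖ = 1)
    (hmax : ∀ z : EuclideanSpace ℂ ι, ‖contract v (fun _ => z.ofLp)‖ ≤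
        ‖contract v (fun _ => u.ofLp)‖ * ‖z‖ ^ k)
    (hw : ‖w‖ ≤ 1) (huw : inner ℂ u w = 0) {s : Finset (Fin k)} (hs : s.card ≠ 0)
    (hsD : s.card ≤ D) :
    ‖contract v (s.piecewise (fun _ => w.ofLp) fun _ => u.ofLp)‖ ≤
      (Real.exp 1 * (2 ^ D * D.factorial) / √k) * ‖contract v (fun _ => u.ofLp)‖ := by
  set p := ‖contract v (fun _ => u.ofLp)‖ with hp
  set j := s.card with hj
  have hk0 : (0 : ℝ) < k := by exact_mod_cast hk
  have hsq : (0 : ℝ) < √k := Real.sqrt_pos.mpr hk0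
  have hbound : ∀ t : ℂ, ‖t‖ = (√k)⁻¹ →
      ‖contract v (fun _ => u.ofLp + t • w.ofLp)‖ ≤ Real.exp 1 * p := by
    intro t ht
    refine (hmax (u + t • w)).trans ?_
    rw [mul_comm]
    refine mul_le_mul_of_nonneg_right ?_ (norm_nonneg _)
    have h1 : ‖u + t • w‖ ^ 2 ≤ 1 + (k : ℝ)⁻¹ := by
      have h := norm_add_sq_eq_norm_sq_add_norm_sq_of_inner_eq_zero (𝕜 := ℂ) u (t • w)
        (by rw [inner_smul_right, huw, mul_zero])
      rw [pow_two, h, hu, norm_smul, ht, one_mul]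
      have h2 : (√k)⁻¹ * (√k)⁻¹ = (k : ℝ)⁻¹ := by
        rw [← mul_inv, Real.mul_self_sqrt hk0.le]
      have h3 : ‖w‖ * ‖w‖ ≤ 1 := mul_le_one₀ hw (norm_nonneg _) hw
      calc 1 + (√k)⁻¹ * ‖w‖ * ((√k)⁻¹ * ‖w‖) = 1 + (k : ℝ)⁻¹ * (‖w‖ * ‖w‖) := by
            rw [← h2]; ring
        _ ≤ 1 + (k : ℝ)⁻¹ * 1 := by gcongr
        _ = _ := by rw [mul_one]
    have h2 : (‖u + t • w‖ ^ k) ^ 2 ≤ Real.exp 1 := by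
      calc (‖u + t • w‖ ^ k) ^ 2 = (‖u + t • w‖ ^ 2) ^ k := by ring
        _ ≤ (1 + (k : ℝ)⁻¹) ^ k := by gcongr
        _ ≤ (Real.exp (k : ℝ)⁻¹) ^ k := by
          gcongr
          rw [add_comm]
          exact Real.add_one_le_exp _
        _ = Real.exp 1 := by
          rw [← Real.exp_nat_mul, mul_inv_cancel₀ hk0.ne']
    have h3 : 1 ≤ Real.exp 1 := Real.one_le_exp zero_le_one
    refine abs_le_of_sq_le_sq' (h2.trans ?_) (by positivity) |>.2
    nlinarith
  have h := choose_mul_norm_contract_piecewise_le v u.ofLp w.ofLp (inv_pos.mpr hsq) hbound s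
  rw [← hj] at h
  set c := ‖contract v (s.piecewise (fun _ => w.ofLp) fun _ => u.ofLp)‖ with hc
  have hc0 : 0 ≤ c := norm_nonneg _
  rw [inv_pow, ← div_eq_mul_inv, div_le_iff₀ (pow_pos hsq j)] at h
  have h1 := pow_le_choose_mul (k := k) (j := j) (by omega)
  have h2 : (√k) ^ j * (√k) ^ j = (k : ℝ) ^ j := by
    rw [← mul_pow, Real.mul_self_sqrt hk0.le]
  have h3 : √k ≤ (√k) ^ j := by
    refine le_self_pow₀ ?_ hs
    rw [Real.one_le_sqrt]
    exact_mod_cast hk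
  have h4 : (2 : ℝ) ^ j * j.factorial ≤ 2 ^ D * D.factorial := by
    have : j.factorial ≤ D.factorial := Nat.factorial_le hsD
    gcongr
    norm_num
  have hp0 : 0 ≤ p := norm_nonneg _
  have h5 : (√k) ^ j * ((√k) ^ j * c) ≤
      (√k) ^ j * (2 ^ D * D.factorial * (Real.exp 1 * p)) := by
    calc (√k) ^ j * ((√k) ^ j * c) = (k : ℝ) ^ j * c := by rw [← h2]; ring
      _ ≤ (2 ^ j * j.factorial * k.choose j) * c := by gcongr
      _ = (2 ^ j * j.factorial) * (k.choose j * c) := by ring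
      _ ≤ (2 ^ D * D.factorial) * (Real.exp 1 * p * (√k) ^ j) := by gcongr
      _ = _ := by ring
  have h6 := le_of_mul_le_mul_left h5 (pow_pos hsq j)
  rw [div_mul_eq_mul_div, le_div_iff₀ hsq]
  calc c * √k ≤ c * (√k) ^ j := by gcongr
    _ = (√k) ^ j * c := mul_comm _ _
    _ ≤ _ := h6
    _ = _ := by ring

/-- Write `z = α u + w` with `w ⊥ u` and expand over the subsets of slots holding `w`. The empty
subset gives the main term `α ^ D p`; each of the fewer than `2 ^ D` others is small by the previous
estimate. -/
theorem norm_contract_contractPow_sub_le {D m : ℕ} (hk : 1 ≤ D + m) (hD : 2 * D ≤ D + m)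
    {v : symSubspace ι (D + m)} {u z : EuclideanSpace ℂ ι} (hu : ‖u‖ = 1)
    (hmax : ∀ z : EuclideanSpace ℂ ι, ‖contract v (fun _ => z.ofLp)‖ ≤
        ‖contract v (fun _ => u.ofLp)‖ * ‖z‖ ^ (D + m))
    (hz : ‖z‖ = 1) :
    ‖contract (contractPow v u.ofLp) (fun _ => z.ofLp) -
        (inner ℂ u z) ^ D * contract v (fun _ => u.ofLp)‖ ≤
      2 ^ D * (Real.exp 1 * (2 ^ D * D.factorial) / √(D + m : ℕ)) *
        ‖contract v (fun _ => u.ofLp)‖ := by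
  classical
  set ε := Real.exp 1 * (2 ^ D * D.factorial) / √(D + m : ℕ) with hε
  set p := contract v (fun _ => u.ofLp) with hp
  set α : ℂ := inner ℂ u z with hα
  set w : EuclideanSpace ℂ ι := z - α • u with hw
  have huu : inner ℂ u u = (1 : ℂ) := by rw [inner_self_eq_norm_sq_to_K, hu]; simp
  have huw : inner ℂ u w = 0 := by
    rw [hw, inner_sub_right, inner_smul_right, huu, ← hα, mul_one, sub_self]
  have hα1 : ‖α‖ ≤ 1 := by
    have := norm_inner_le_norm (𝕜 := ℂ) u z
    rwa [hu, hz, one_mul] at this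
  have hzw : z = α • u + w := by rw [hw]; abel
  have hw1 : ‖w‖ ≤ 1 := by
    have h := norm_add_sq_eq_norm_sq_add_norm_sq_of_inner_eq_zero (𝕜 := ℂ) (α • u) w
      (by rw [inner_smul_left, huw, mul_zero])
    rw [← hzw, hz] at h
    nlinarith [norm_nonneg w, mul_self_nonneg ‖α • u‖]
  have h1 := contract_add_smul (contractPow v u.ofLp) u.ofLp w.ofLp α 1
  have h2 : (fun _ : Fin D => α • u.ofLp + (1 : ℂ) • w.ofLp) = fun _ => z.ofLp := by
    funext _
    rw [one_smul, ← WithLp.ofLp_smul, ← WithLp.ofLp_add, ← hzw]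
  have happ : ∀ s : Finset (Fin D),
      (Fin.append (s.piecewise (fun _ => w.ofLp) fun _ => u.ofLp) fun _ : Fin m => u.ofLp) =
        (s.map (Fin.castAddEmb m)).piecewise (fun _ => w.ofLp) fun _ => u.ofLp := by
    intro s
    funext j
    refine Fin.addCases (fun j => ?_) (fun j => ?_) j
    · rw [Fin.append_left]
      have : (Fin.castAdd m j ∈ s.map (Fin.castAddEmb m)) ↔ j ∈ s :=
        Finset.mem_map' (Fin.castAddEmb m)
      simp only [Finset.piecewise, this]
    · rw [Fin.append_right, Finset.piecewise_eq_of_notMem]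
      simp only [Finset.mem_map, not_exists, not_and]
      intro i _ h
      have := congrArg Fin.val h
      simp at this
      omega
  rw [h2, ← Finset.add_sum_erase _ _ (Finset.mem_univ ∅)] at h1
  have h3 : contract (contractPow v u.ofLp)
      ((∅ : Finset (Fin D)).piecewise (fun _ => w.ofLp) fun _ => u.ofLp) = p := by
    rw [contract_contractPow, happ, Finset.map_empty, Finset.piecewise_empty]
  rw [h1, h3]
  simp only [Finset.card_empty, one_pow, one_mul, Nat.sub_zero, add_sub_cancel_left]
  have hε0 : 0 ≤ ε * ‖p‖ := by positivity
  refine (norm_sum_le_of_le (f := fun s : Finset (Fin D) => α ^ (D - s.card) *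
    contract (contractPow v u.ofLp) (s.piecewise (fun _ => w.ofLp) fun _ => u.ofLp))
    (n := fun _ => ε * ‖p‖) _ ?_).trans ?_
  · intro s hs
    rw [norm_mul, norm_pow, contract_contractPow, happ]
    have hs0 : (s.map (Fin.castAddEmb m)).card ≠ 0 := by
      rw [Finset.card_map]
      exact Finset.card_ne_zero.mpr (Finset.nonempty_iff_ne_empty.mpr (Finset.ne_of_mem_erase hs))
    have hsD : (s.map (Fin.castAddEmb m)).card ≤ D := by
      rw [Finset.card_map]
      simpa using s.card_le_univ
    have := norm_contract_piecewise_le_of_isMax hk hD hu hmax hw1 huw hs0 hsD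
    exact (mul_le_of_le_one_left (norm_nonneg _) (pow_le_one₀ (norm_nonneg _) hα1)).trans this
  · rw [Finset.sum_const, nsmul_eq_mul, mul_assoc]
    refine mul_le_mul_of_nonneg_right ?_ hε0
    have : (Finset.univ.erase (∅ : Finset (Fin D))).card ≤ 2 ^ D := by
      refine (Finset.card_erase_le).trans ?_
      simp
    exact_mod_cast this

end Contraction

/-! ### Tensor powers of vectors and the unconstrained lower bound -/

section Vectors

variable {ι E : Type*} [Fintype ι] [NormedAddCommGroup E] [InnerProductSpace ℂ E]

theorem vecPow_apply (b : OrthonormalBasis ι ℂ E) (k : ℕ) (z : E) (w : Fin k → ι) :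
    (vecPow b k z : TensorPow ι k) w = ∏ j, b.repr z (w j) := rfl

theorem inner_vecPow_eq_contract (b : OrthonormalBasis ι ℂ E) {k : ℕ} (z : E)
    (v : symSubspace ι k) :
    inner ℂ (vecPow b k z) v = contract v (fun _ i => star (b.repr z i)) := by
  rw [Submodule.coe_inner, PiLp.inner_apply]
  refine Finset.sum_congr rfl fun w _ => ?_
  rw [RCLike.inner_apply, vecPow_apply, map_prod]
  rfl

theorem contract_vecPow (b : OrthonormalBasis ι ℂ E) (k : ℕ) (z : E) (y : ι → ℂ) :
    contract (vecPow b k z) (fun _ => y) = (∑ i, b.repr z i * y i) ^ k := by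
  simp only [contract, vecPow_apply, ← Finset.prod_mul_distrib]
  rw [← Fin.prod_const, Finset.prod_univ_sum]
  simp

theorem inner_vecPow_vecPow (b : OrthonormalBasis ι ℂ E) (k : ℕ) (y z : E) :
    inner ℂ (vecPow b k y) (vecPow b k z) = (inner ℂ y z) ^ k := by
  rw [inner_vecPow_eq_contract, contract_vecPow, ← b.repr.inner_map_map, PiLp.inner_apply]
  rfl

theorem norm_vecPow (b : OrthonormalBasis ι ℂ E) (k : ℕ) (z : E) :
    ‖vecPow b k z‖ = ‖z‖ ^ k := by
  have h := (inner_self_eq_norm_sq_to_K (𝕜 := ℂ) (vecPow b k z)).symm.trans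
    (inner_vecPow_vecPow b k z z)
  rw [inner_self_eq_norm_sq_to_K] at h
  have h' : ‖vecPow b k z‖ ^ 2 = (‖z‖ ^ 2) ^ k := by exact_mod_cast h
  rw [← pow_mul, mul_comm, pow_mul] at h'
  exact (pow_left_inj₀ (norm_nonneg _) (by positivity) two_ne_zero).mp h'

theorem sliceSym_vecPow (b : OrthonormalBasis ι ℂ E) {k m : ℕ} (z : E) (u : Fin m → ι) :
    sliceSym u (vecPow b (k + m) z) = (∏ j, b.repr z (u j)) • vecPow b k z := by
  ext a
  rw [sliceSym_apply, vecPow_apply, Fin.prod_univ_add]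
  simp only [Fin.append_left, Fin.append_right]
  exact mul_comm _ _

theorem vecPow_smul (b : OrthonormalBasis ι ℂ E) (k : ℕ) (c : ℂ) (z : E) :
    vecPow b k (c • z) = c ^ k • vecPow b k z := by
  ext a
  change ∏ j, b.repr (c • z) (a j) = c ^ k * ∏ j, b.repr z (a j)
  simp [Finset.prod_mul_distrib]

theorem continuous_vecPow (b : OrthonormalBasis ι ℂ E) (k : ℕ) : Continuous (vecPow b k) := by
  refine Continuous.subtype_mk ?_ _
  refine (PiLp.continuous_toLp 2 _).comp (continuous_pi fun w => ?_)
  refine continuous_finsetProd _ fun j _ => ?_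
  exact (EuclideanSpace.proj (w j) : EuclideanSpace ℂ ι →L[ℂ] ℂ).continuous.comp
    b.repr.continuous

theorem continuous_formValue (b : OrthonormalBasis ι ℂ E) {d : ℕ}
    (H : symSubspace ι d →ₗ[ℂ] symSubspace ι d) : Continuous (formValue b H) := by
  have hH : Continuous H := LinearMap.continuous_of_finiteDimensional (E := symSubspace ι d) H
  exact Complex.continuous_re.comp
    (Continuous.inner (𝕜 := ℂ) (E := symSubspace ι d) (continuous_vecPow b d) (hH.comp (continuous_vecPow b d)))

theorem inner_vecPow_liftForm (b : OrthonormalBasis ι ℂ E) {d m : ℕ}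
    (A : symSubspace ι d →ₗ[ℂ] symSubspace ι d) (z : E) (v : symSubspace ι (d + m)) :
    inner ℂ (vecPow b (d + m) z) (liftForm A m v) =
      inner ℂ (vecPow b d z) (A (contractPow v fun i => star (b.repr z i))) := by
  rw [inner_liftForm_eq_sum, contractPow, map_sum]
  refine Eq.trans ?_ (inner_sum (𝕜 := ℂ) (E := symSubspace ι d) _ _ _).symm
  refine Finset.sum_congr rfl fun t _ => ?_
  rw [sliceSym_vecPow, map_smul]
  refine (inner_smul_left (𝕜 := ℂ) (E := symSubspace ι d) _ _ _).trans
    (Eq.trans ?_ (inner_smul_right (𝕜 := ℂ) (E := symSubspace ι d) _ _ _).symm)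
  rw [map_prod]
  rfl

theorem eventually_le_inner_liftForm (b : OrthonormalBasis ι ℂ E) {D : ℕ}
    {A : symSubspace ι D →ₗ[ℂ] symSubspace ι D}
    (hA : LinearMap.IsSymmetric (𝕜 := ℂ) (E := symSubspace ι D) A) {c : ℝ}
    (hc : ∀ z : E, ‖z‖ = 1 → c ≤ formValue b A z) {ε : ℝ} (hε : 0 < ε) :
    ∀ᶠ m in Filter.atTop, ∀ v : symSubspace ι (D + m),
      (c - ε) * ‖v‖ ^ 2 ≤ (inner ℂ v (liftForm A m v)).re := by
  -- Over the zero space there are no unit vectors to test on, but every tensor of positive degree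
  -- is zero.
  rcases isEmpty_or_nonempty ι with hι | hι
  · filter_upwards [Filter.eventually_ge_atTop 1] with m hm v
    have hv : v = 0 := by
      ext a
      exact isEmptyElim (a ⟨0, by omega⟩)
    subst hv
    rw [norm_zero, map_zero]
    refine le_of_eq ?_
    have : inner ℂ (0 : symSubspace ι (D + m)) (0 : symSubspace ι (D + m)) = (0 : ℂ) :=
      inner_zero_left (𝕜 := ℂ) (E := symSubspace ι (D + m)) _
    rw [this]
    simp
  obtain ⟨K, hK0, hK⟩ := exists_norm_le_of_norm_contract_le (ι := ι) D
  let A' := LinearMap.toContinuousLinearMap (E := symSubspace ι D) (F' := symSubspace ι D) A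
  have hlim : Filter.Tendsto (fun m : ℕ => ‖A'‖ * (K * (2 ^ D *
      (Real.exp 1 * (2 ^ D * D.factorial) / √(D + m : ℕ))))) Filter.atTop (nhds 0) := by
    have h1 : Filter.Tendsto (fun m : ℕ => √((D + m : ℕ) : ℝ)) Filter.atTop Filter.atTop :=
      Real.tendsto_sqrt_atTop.comp (tendsto_natCast_atTop_atTop.comp
        (Filter.tendsto_atTop_mono (fun m => Nat.le_add_left m D) Filter.tendsto_id))
    have h2 := ((((h1.const_div_atTop (Real.exp 1 * (2 ^ D * D.factorial))).const_mul
      (2 ^ D)).const_mul K).const_mul ‖A'‖)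
    simpa using h2
  filter_upwards [Filter.eventually_ge_atTop (D + 1), hlim.eventually (ge_mem_nhds hε)]
    with m hm hsmall v
  rcases subsingleton_or_nontrivial (symSubspace ι (D + m)) with hsub | hnt
  · rw [Subsingleton.elim v 0, norm_zero, map_zero]
    refine le_of_eq ?_
    have : inner ℂ (0 : symSubspace ι (D + m)) (0 : symSubspace ι (D + m)) = (0 : ℂ) :=
      inner_zero_left (𝕜 := ℂ) (E := symSubspace ι (D + m)) _
    rw [this]
    simp
  obtain ⟨μ, hμ, hmin⟩ := exists_eigenvalue_le_inner (V := symSubspace ι (D + m))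
    (isSymmetric_liftForm hA m)
  refine le_trans (mul_le_mul_of_nonneg_right ?_ (sq_nonneg _)) (hmin v)
  obtain ⟨x, hx⟩ := hμ.exists_hasEigenvector
  obtain ⟨u, hu, hp, hmax⟩ := exists_forall_norm_contract_le (by omega) hx.2
  -- The conjugate of `u`, because the inner product with `z^{⊗k}` contracts with conjugated
  -- coordinates.
  let z : E := b.repr.symm (WithLp.toLp 2 fun i => star (u i))
  have hz : ∀ i, b.repr z i = star (u i) := fun i => by simp [z]
  have hzu : (fun i => star (b.repr z i)) = u.ofLp := by
    funext i
    rw [hz, star_star]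
  have hz1 : ‖z‖ = 1 := by
    rw [← b.repr.norm_map, ← hu, EuclideanSpace.norm_eq, EuclideanSpace.norm_eq]
    simp [hz]
  set p := contract x (fun _ => u.ofLp) with hpdef
  have hpos : 0 < ‖p‖ := norm_pos_iff.mpr hp
  set X := contractPow x u.ofLp with hX
  set Z := vecPow b D z with hZ
  -- The error in `X ≈ p z^{⊗D}`; its diagonal values, and hence its norm, are `O(‖p‖/√k)`. The
  -- factor `‖p‖` cancels at the end.
  set Y := X - p • Z with hY
  have hYnorm : ‖Y‖ ≤ K * (2 ^ D * (Real.exp 1 * (2 ^ D * D.factorial) / √(D + m : ℕ)) * ‖p‖) := by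
    refine hK Y _ (by positivity) fun y hy => ?_
    have h1 := norm_contract_contractPow_sub_le (by omega) (by omega) hu hmax hy
    have h2 : contract Y (fun _ => y.ofLp) =
        contract X (fun _ => y.ofLp) - (inner ℂ u y) ^ D * p := by
      rw [hY, contract_sub, contract_smul, hZ, contract_vecPow, PiLp.inner_apply, mul_comm p]
      congr 3
      refine Finset.sum_congr rfl fun i _ => ?_
      rw [hz, RCLike.inner_apply, mul_comm]
      rfl
    rw [h2]
    exact h1
  have hAY : ‖A Y‖ ≤ ‖A'‖ * ‖Y‖ := A'.le_opNorm Y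
  have hμp : (μ : ℂ) * p = inner ℂ Z (A X) := by
    have h1 := inner_vecPow_liftForm b A z x
    rw [hzu, hx.apply_eq_smul] at h1
    rw [← h1]
    refine Eq.trans ?_ (inner_smul_right (𝕜 := ℂ) _ _ _).symm
    rw [inner_vecPow_eq_contract, hzu]
  have hsplit : inner ℂ Z (A X) = p * inner ℂ Z (A Z) + inner ℂ Z (A Y) := by
    have hXY : X = p • Z + Y := by rw [hY]; abel
    rw [hXY, map_add, map_smul]
    refine (inner_add_right (𝕜 := ℂ) (E := symSubspace ι D) _ _ _).trans ?_
    congr 1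
    exact inner_smul_right (𝕜 := ℂ) (E := symSubspace ι D) _ _ _
  have hdiff : ‖p * ((μ : ℂ) - inner ℂ Z (A Z))‖ ≤ ‖p‖ * ε := by
    have h1 : p * ((μ : ℂ) - inner ℂ Z (A Z)) = inner ℂ Z (A Y) := by
      rw [mul_sub, mul_comm p, hμp, hsplit]
      ring
    have h2 : ‖(inner ℂ Z (A Y) : ℂ)‖ ≤ ‖Z‖ * ‖A Y‖ :=
      norm_inner_le_norm (𝕜 := ℂ) (E := symSubspace ι D) _ _
    have h3 : ‖Z‖ = 1 := by rw [hZ, norm_vecPow, hz1, one_pow]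
    rw [h1]
    rw [h3, one_mul] at h2
    calc ‖(inner ℂ Z (A Y) : ℂ)‖ ≤ ‖A'‖ * ‖Y‖ := h2.trans hAY
      _ ≤ ‖A'‖ * (K * (2 ^ D * (Real.exp 1 * (2 ^ D * D.factorial) / √(D + m : ℕ)) * ‖p‖)) := by
        gcongr
      _ = ‖p‖ * (‖A'‖ * (K * (2 ^ D * (Real.exp 1 * (2 ^ D * D.factorial) / √(D + m : ℕ))))) := by
        ring
      _ ≤ ‖p‖ * ε := by gcongr
  rw [norm_mul] at hdiff
  have h4 := (Complex.abs_re_le_norm _).trans (le_of_mul_le_mul_left hdiff hpos)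
  have h5 := hc z hz1
  unfold formValue at h5
  rw [Complex.sub_re, Complex.ofReal_re] at h4
  have h6 := (abs_le.mp h4).1
  linarith

/-! ### The variety in terms of tensor powers -/

theorem vecPow_mem_idealPerp_iff (b : OrthonormalBasis ι ℂ E) {I : Ideal (MvPolynomial ι ℂ)}
    {k : ℕ} {z : E} : vecPow b k z ∈ idealPerp I k ↔
      ∀ f ∈ I, f.IsHomogeneous k → MvPolynomial.eval (fun i => b.repr z i) f = 0 := by
  rw [mem_idealPerp_iff]
  constructor
  · intro h f hf hk
    obtain ⟨T, rfl⟩ := exists_tensorPoly_eq hk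
    rw [eval_tensorPoly]
    exact h T hf
  · intro h T hT
    have h1 := h _ hT (by
      refine MvPolynomial.IsHomogeneous.sum _ _ _ fun w _ => ?_
      have h2 := MvPolynomial.IsHomogeneous.prod (Finset.univ : Finset (Fin k))
        (fun j => (MvPolynomial.X (w j) : MvPolynomial ι ℂ)) (fun _ => 1)
        fun j _ => MvPolynomial.isHomogeneous_X _ _
      simpa using (MvPolynomial.isHomogeneous_C ι (T w)).mul h2)
    rwa [eval_tensorPoly] at h1

theorem forall_eval_eq_zero_iff (b : OrthonormalBasis ι ℂ E) {I : Ideal (MvPolynomial ι ℂ)}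
    (hI : I.IsHomogeneous (MvPolynomial.homogeneousSubmodule ι ℂ)) {z : E} :
    (∀ f ∈ I, MvPolynomial.eval (fun i => b.repr z i) f = 0) ↔
      ∀ k, vecPow b k z ∈ idealPerp I k := by
  simp only [vecPow_mem_idealPerp_iff]
  refine ⟨fun h k f hf _ => h f hf, fun h f hf => ?_⟩
  rw [← MvPolynomial.sum_homogeneousComponent f, map_sum]
  refine Finset.sum_eq_zero fun k _ => h k _ ?_ (MvPolynomial.homogeneousComponent_isHomogeneous k f)
  rw [← MvPolynomial.decomposition.decompose'_apply]
  exact hI k hf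

/-- Slicing `z^{⊗(k+m)}` along an index where `z` has a nonzero coordinate gives a nonzero multiple
of `z^{⊗k}`. Thus the vanishing conditions become stronger as the degree grows. -/
theorem vecPow_mem_idealPerp_of_add (b : OrthonormalBasis ι ℂ E) {I : Ideal (MvPolynomial ι ℂ)}
    {k m : ℕ} {z : E} (hz : z ≠ 0) (h : vecPow b (k + m) z ∈ idealPerp I (k + m)) :
    vecPow b k z ∈ idealPerp I k := by
  obtain ⟨i, hi⟩ : ∃ i, b.repr z i ≠ 0 := by
    by_contra! h0
    exact hz (b.repr.injective (by ext i; simp [h0]))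
  have h1 := sliceSym_mem_idealPerp (fun _ : Fin m => i) h
  rw [sliceSym_vecPow] at h1
  exact (Submodule.smul_mem_iff _ (Finset.prod_ne_zero_iff.mpr fun _ _ => hi)).mp h1

/-- The projector `z z^*` determines the unit vector `z` up to a phase, and a phase only rescales
tensor powers. -/
theorem rankOne_mem_projVariety_iff (b : OrthonormalBasis ι ℂ E) {I : Ideal (MvPolynomial ι ℂ)}
    (hI : I.IsHomogeneous (MvPolynomial.homogeneousSubmodule ι ℂ)) {z : E} :
    InnerProductSpace.rankOne ℂ z z ∈ projVariety b I ↔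
      ‖z‖ = 1 ∧ ∀ k, vecPow b k z ∈ idealPerp I k := by
  constructor
  · rintro ⟨y, hy, hf, h⟩
    rw [forall_eval_eq_zero_iff b hI] at hf
    have hn : ‖z‖ = 1 := by
      have := congrArg norm h
      rw [InnerProductSpace.norm_rankOne, InnerProductSpace.norm_rankOne, hy, mul_one] at this
      nlinarith [norm_nonneg z]
    have hz := congrArg (fun T : E →L[ℂ] E => T z) h
    simp only [InnerProductSpace.rankOne_apply] at hz
    rw [inner_self_eq_norm_sq_to_K, hn] at hz
    have hz' : z = (inner ℂ y z : ℂ) • y := by simpa using hz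
    refine ⟨hn, fun k => ?_⟩
    rw [hz', vecPow_smul]
    exact Submodule.smul_mem _ _ (hf k)
  · rintro ⟨hz, h⟩
    exact ⟨z, hz, (forall_eval_eq_zero_iff b hI).mpr h, rfl⟩

end Vectors

/-! ### The penalty operator and compressions to a subspace -/

theorem exists_isSymmetric_vanishing_exactly_on {V : Type*} [NormedAddCommGroup V]
    [InnerProductSpace ℂ V] [FiniteDimensional ℂ V] (K : Submodule ℂ V) :
    ∃ Q : V →ₗ[ℂ] V, Q.IsSymmetric ∧ (∀ v, 0 ≤ (inner ℂ v (Q v)).re) ∧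
      (∀ v ∈ K, Q v = 0) ∧ ∀ v, (inner ℂ v (Q v)).re = 0 → v ∈ K := by
  have h : ∀ v, (inner ℂ v (v - K.starProjection v)).re = ‖v - K.starProjection v‖ ^ 2 := by
    intro v
    have h1 : inner ℂ (K.starProjection v) (v - K.starProjection v) = 0 :=
      K.sub_starProjection_mem_orthogonal v _ (K.starProjection_apply_mem v)
    have h2 : inner ℂ v (v - K.starProjection v) =
        inner ℂ (v - K.starProjection v) (v - K.starProjection v) := by
      rw [inner_sub_left v, h1, sub_zero]
    rw [h2, inner_self_eq_norm_sq_to_K]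
    norm_cast
  refine ⟨LinearMap.id - K.starProjection.toLinearMap, ?_, fun v => ?_, fun v hv => ?_,
    fun v hv => ?_⟩
  · intro v w
    have h1 := K.starProjection_isSymmetric v w
    simp only [ContinuousLinearMap.coe_coe] at h1
    simp [inner_sub_left, inner_sub_right, h1]
  · exact (sq_nonneg _).trans_eq (h v).symm
  · simp [K.starProjection_eq_self_iff.mpr hv]
  · have h1 := (h v).symm.trans hv
    rw [sq_eq_zero_iff, norm_eq_zero, sub_eq_zero] at h1
    exact K.starProjection_eq_self_iff.mp h1.symm

theorem le_minEigenvalue_compression {V : Type*} [NormedAddCommGroup V] [InnerProductSpace ℂ V]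
    {K : Submodule ℂ V} [K.HasOrthogonalProjection] {T : V →ₗ[ℂ] V} {c : ℝ}
    (h : ∀ v ∈ K, c * ‖v‖ ^ 2 ≤ (inner ℂ v (T v)).re) :
    (c : EReal) ≤ minEigenvalue (compression K T) := by
  refine le_minEigenvalue_of_forall_le_inner fun v => ?_
  rw [inner_compression]
  exact h v v.2

theorem exists_isLeast_compression {V : Type*} [NormedAddCommGroup V] [InnerProductSpace ℂ V]
    [FiniteDimensional ℂ V] {K : Submodule ℂ V} [Nontrivial K] {T : V →ₗ[ℂ] V}
    (hT : T.IsSymmetric) :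
    ∃ ν : ℝ, minEigenvalue (compression K T) = (ν : EReal) ∧
      IsLeast {μ : ℝ | Module.End.HasEigenvalue (compression K T) (μ : ℂ)} ν ∧
      ∀ v ∈ K, ν * ‖v‖ ^ 2 ≤ (inner ℂ v (T v)).re := by
  obtain ⟨ν, h1, h2, h3⟩ := exists_isLeast_eigenvalue (isSymmetric_compression K hT)
  refine ⟨ν, h1, h2, fun v hv => ?_⟩
  have h4 := h3 ⟨v, hv⟩
  rwa [inner_compression] at h4

/-! ### Monotonicity and bounds for the hierarchy -/

section Hierarchy

variable {ι E : Type*} [Fintype ι] [NormedAddCommGroup E] [InnerProductSpace ℂ E]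

theorem le_minEigenvalue_idealCompression {d m : ℕ} {I : Ideal (MvPolynomial ι ℂ)}
    {H : symSubspace ι d →ₗ[ℂ] symSubspace ι d} {c : ℝ}
    (h : ∀ v ∈ idealPerp I (d + m), c * ‖v‖ ^ 2 ≤ (inner ℂ v (liftForm H m v)).re) :
    (c : EReal) ≤ minEigenvalue (idealCompression I H m) :=
  le_minEigenvalue_compression (V := symSubspace ι (d + m)) h

theorem exists_isLeast_idealCompression {d : ℕ} {I : Ideal (MvPolynomial ι ℂ)}
    {H : symSubspace ι d →ₗ[ℂ] symSubspace ι d}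
    (hH : LinearMap.IsSymmetric (𝕜 := ℂ) (E := symSubspace ι d) H) (m : ℕ)
    [Nontrivial (idealPerp I (d + m))] :
    ∃ ν : ℝ, minEigenvalue (idealCompression I H m) = (ν : EReal) ∧
      IsLeast {μ : ℝ | Module.End.HasEigenvalue (idealCompression I H m) (μ : ℂ)} ν ∧
      ∀ v ∈ idealPerp I (d + m), ν * ‖v‖ ^ 2 ≤ (inner ℂ v (liftForm H m v)).re :=
  exists_isLeast_compression (V := symSubspace ι (d + m)) (isSymmetric_liftForm hH m)

theorem le_inner_liftForm_add {d m₀ : ℕ} {I : Ideal (MvPolynomial ι ℂ)}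
    {H : symSubspace ι d →ₗ[ℂ] symSubspace ι d} {c : ℝ}
    (h : ∀ v ∈ idealPerp I (d + m₀), c * ‖v‖ ^ 2 ≤ (inner ℂ v (liftForm H m₀ v)).re) (m : ℕ) :
    ∀ v ∈ idealPerp I (d + (m₀ + m)),
      c * ‖v‖ ^ 2 ≤ (inner ℂ v (liftForm H (m₀ + m) v)).re := by
  intro v hv
  rw [inner_liftForm_castSym, ← norm_castSym (Nat.add_assoc d m₀ m).symm v,
    norm_sq_eq_sum_sliceSym, Finset.mul_sum, Complex.re_sum]
  exact Finset.sum_le_sum fun u _ =>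
    h _ (sliceSym_mem_idealPerp u (castSym_mem_idealPerp _ hv))

theorem minEigenvalue_eq_top_of_subsingleton {V : Type*} [AddCommGroup V] [Module ℂ V]
    [Subsingleton V] (T : V →ₗ[ℂ] V) : minEigenvalue T = ⊤ := by
  refine iInf₂_eq_top.mpr fun μ hμ => ?_
  obtain ⟨v, hv⟩ := Module.End.HasEigenvalue.exists_hasEigenvector hμ
  exact (hv.2 (Subsingleton.elim _ _)).elim

theorem monotone_minEigenvalue_idealCompression {d : ℕ} {I : Ideal (MvPolynomial ι ℂ)}
    {H : symSubspace ι d →ₗ[ℂ] symSubspace ι d}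
    (hH : LinearMap.IsSymmetric (𝕜 := ℂ) (E := symSubspace ι d) H) :
    Monotone fun m : ℕ => minEigenvalue (idealCompression I H m) := by
  refine monotone_nat_of_le_succ fun m => ?_
  rcases subsingleton_or_nontrivial (idealPerp I (d + m)) with hs | hn
  -- If the annihilator vanishes at one level, all slices from the next level vanish, so it vanishes
  -- there too and the value stays `⊤`.
  · have hzero : ∀ v ∈ idealPerp I (d + (m + 1)), v = 0 := by
      intro v hv
      rw [← norm_eq_zero, ← sq_eq_zero_iff, ← norm_castSym (Nat.add_assoc d m 1).symm v,
        norm_sq_eq_sum_sliceSym]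
      refine Finset.sum_eq_zero fun u _ => ?_
      have h := sliceSym_mem_idealPerp u (castSym_mem_idealPerp (Nat.add_assoc d m 1).symm hv)
      have h0 : (⟨_, h⟩ : idealPerp I (d + m)) = 0 := Subsingleton.elim _ _
      rw [sq_eq_zero_iff, norm_eq_zero]
      exact congrArg Subtype.val h0
    have : Subsingleton (idealPerp I (d + (m + 1))) :=
      ⟨fun v w => Subtype.ext ((hzero v v.2).trans (hzero w w.2).symm)⟩
    rw [minEigenvalue_eq_top_of_subsingleton (idealCompression I H (m + 1))]
    exact le_top
  · obtain ⟨ν, h1, -, h3⟩ := exists_isLeast_idealCompression (I := I) hH m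
    rw [h1]
    exact le_minEigenvalue_idealCompression (le_inner_liftForm_add h3 1)

theorem formValue_liftForm (b : OrthonormalBasis ι ℂ E) {d : ℕ}
    (H : symSubspace ι d →ₗ[ℂ] symSubspace ι d) (m : ℕ) {z : E} (hz : ‖z‖ = 1) :
    formValue b (liftForm H m) z = formValue b H z := by
  unfold formValue
  rw [inner_liftForm, hz]
  simp

theorem nontrivial_idealPerp (b : OrthonormalBasis ι ℂ E) {I : Ideal (MvPolynomial ι ℂ)} {k : ℕ}
    {z : E} (hz : ‖z‖ = 1) (h : vecPow b k z ∈ idealPerp I k) : Nontrivial (idealPerp I k) := by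
  refine nontrivial_of_ne ⟨_, h⟩ 0 fun h0 => ?_
  have h1 := norm_vecPow b k z
  have h2 : vecPow b k z = 0 := congrArg Subtype.val h0
  rw [h2, hz, one_pow, norm_zero] at h1
  exact zero_ne_one h1

theorem minEigenvalue_idealCompression_le (b : OrthonormalBasis ι ℂ E) {d : ℕ}
    {I : Ideal (MvPolynomial ι ℂ)} {H : symSubspace ι d →ₗ[ℂ] symSubspace ι d}
    (hH : LinearMap.IsSymmetric (𝕜 := ℂ) (E := symSubspace ι d) H) (m : ℕ) {z : E} (hz : ‖z‖ = 1)
    (h : vecPow b (d + m) z ∈ idealPerp I (d + m)) :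
    minEigenvalue (idealCompression I H m) ≤ (formValue b H z : EReal) := by
  have := nontrivial_idealPerp b hz h
  obtain ⟨ν, h1, -, h3⟩ := exists_isLeast_idealCompression (I := I) hH m
  have h4 := h3 _ h
  rw [norm_vecPow, hz, one_pow, one_pow, mul_one] at h4
  rw [h1, ← formValue_liftForm b H m hz]
  exact_mod_cast h4

/-- Otherwise the sets of `z ∈ S` passing the test at level `d + m` are nonempty, compact and
decreasing, so Cantor's intersection theorem gives a point of `S` passing every test. -/
theorem exists_forall_notMem_idealPerp (b : OrthonormalBasis ι ℂ E) (d : ℕ)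
    {I : Ideal (MvPolynomial ι ℂ)} {S : Set E} (hS : IsCompact S) (h1 : ∀ z ∈ S, ‖z‖ = 1)
    (h : ∀ z ∈ S, ∃ k, vecPow b k z ∉ idealPerp I k) :
    ∃ m, ∀ z ∈ S, vecPow b (d + m) z ∉ idealPerp I (d + m) := by
  by_contra! hcon
  have hclosed : ∀ m, IsClosed {z : E | vecPow b (d + m) z ∈ idealPerp I (d + m)} := fun m =>
    (Submodule.closed_of_finiteDimensional (idealPerp I (d + m))).preimage
      (continuous_vecPow b (d + m))
  have hne0 : ∀ z ∈ S, z ≠ 0 := fun z hz => norm_ne_zero_iff.mp (by rw [h1 z hz]; exact one_ne_zero)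
  obtain ⟨z, hz⟩ := IsCompact.nonempty_iInter_of_sequence_nonempty_isCompact_isClosed
    (fun m => S ∩ {z : E | vecPow b (d + m) z ∈ idealPerp I (d + m)})
    (fun m z hz => ⟨hz.1, vecPow_mem_idealPerp_of_add b (k := d + m) (m := 1) (hne0 z hz.1) hz.2⟩)
    hcon (hS.inter_right (hclosed 0)) (fun m => hS.isClosed.inter (hclosed m))
  rw [Set.mem_iInter] at hz
  have hzS := (hz 0).1
  obtain ⟨k, hk⟩ := h z hzS
  refine hk (vecPow_mem_idealPerp_of_add b (m := d) (hne0 z hzS) ?_)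
  have := (hz k).2
  rw [Nat.add_comm]
  exact this

theorem exists_sub_le_minEigenvalue_idealCompression (b : OrthonormalBasis ι ℂ E) {d : ℕ}
    {I : Ideal (MvPolynomial ι ℂ)} {H : symSubspace ι d →ₗ[ℂ] symSubspace ι d}
    (hH : LinearMap.IsSymmetric (𝕜 := ℂ) (E := symSubspace ι d) H) {c : ℝ}
    (hc : ∀ z : E, ‖z‖ = 1 → (∀ k, vecPow b k z ∈ idealPerp I k) → c < formValue b H z)
    {ε : ℝ} (hε : 0 < ε) :
    ∃ m, ((c - ε : ℝ) : EReal) ≤ minEigenvalue (idealCompression I H m) := by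
  have : FiniteDimensional ℂ E := b.toBasis.finiteDimensional_of_finite
  have : ProperSpace E := FiniteDimensional.proper ℂ E
  let S : Set E := Metric.sphere 0 1 ∩ {z | formValue b H z ≤ c}
  have hS : IsCompact S := (isCompact_sphere (0 : E) 1).inter_right
    (isClosed_le (continuous_formValue b H) continuous_const)
  have hS1 : ∀ z ∈ S, ‖z‖ = 1 := fun z hz => by simpa using hz.1
  obtain ⟨m₀, hm₀⟩ := exists_forall_notMem_idealPerp b d (I := I) hS hS1 (by
    intro z hz
    by_contra! h
    exact absurd hz.2 (not_le.mpr (hc z (hS1 z hz) h)))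
  obtain ⟨Q, hQs, hQ0, hQK, hQ⟩ := exists_isSymmetric_vanishing_exactly_on
    (V := symSubspace ι (d + m₀)) (idealPerp I (d + m₀))
  have hQpos : ∀ z ∈ S, 0 < formValue b Q z := fun z hz =>
    lt_of_le_of_ne (hQ0 _) fun h => hm₀ z hz (hQ _ h.symm)
  -- `N` must satisfy `H + N Q ≥ c` on `S`; the required ratio is continuous there because `Q` is
  -- positive on the compact set `S`. Off `S`, any `N ≥ 0` works.
  obtain ⟨N₀, hN₀⟩ := hS.bddAbove_image
    (f := fun z => (c - formValue b H z) / formValue b Q z)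
    ((continuous_const.sub (continuous_formValue b H)).continuousOn.div
      (continuous_formValue b Q).continuousOn fun z hz => (hQpos z hz).ne')
  set N := max N₀ 0 with hN
  let A : symSubspace ι (d + m₀) →ₗ[ℂ] symSubspace ι (d + m₀) := liftForm H m₀ + (N : ℂ) • Q
  have hAinner : ∀ v : symSubspace ι (d + m₀), (inner ℂ v (A v)).re =
      (inner ℂ v (liftForm H m₀ v)).re + N * (inner ℂ v (Q v)).re := by
    intro v
    have h1 : inner ℂ v (A v) = inner ℂ v (liftForm H m₀ v) + (N : ℂ) * inner ℂ v (Q v) :=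
      (inner_add_right (𝕜 := ℂ) (E := symSubspace ι (d + m₀)) _ _ _).trans
        (congrArg _ (inner_smul_right (𝕜 := ℂ) (E := symSubspace ι (d + m₀)) _ _ _))
    rw [h1, Complex.add_re, Complex.re_ofReal_mul]
  have hAsymm : LinearMap.IsSymmetric (𝕜 := ℂ) (E := symSubspace ι (d + m₀)) A :=
    (isSymmetric_liftForm hH m₀).add (hQs.smul (Complex.conj_ofReal N))
  have hAc : ∀ z : E, ‖z‖ = 1 → c ≤ formValue b A z := by
    intro z hz
    have h1 : formValue b A z = formValue b H z + N * formValue b Q z := by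
      rw [← formValue_liftForm b H m₀ hz]
      exact hAinner _
    rw [h1]
    by_cases hzc : formValue b H z ≤ c
    · have hzS : z ∈ S := ⟨by simpa using hz, hzc⟩
      have h2 := (hN₀ ⟨z, hzS, rfl⟩).trans (le_max_left N₀ 0)
      rw [← hN, div_le_iff₀ (hQpos z hzS)] at h2
      linarith
    · have h2 : 0 ≤ N * formValue b Q z := mul_nonneg (le_max_right _ _) (hQ0 _)
      linarith
  obtain ⟨m, hm⟩ := (eventually_le_inner_liftForm b hAsymm hAc hε).exists
  refine ⟨m₀ + m, le_minEigenvalue_idealCompression fun v hv => ?_⟩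
  have h1 := hm (castSym (Nat.add_assoc d m₀ m).symm v)
  rw [norm_castSym] at h1
  refine h1.trans_eq ?_
  rw [inner_liftForm_castSym, inner_liftForm_eq_sum, Complex.re_sum, Complex.re_sum]
  refine Finset.sum_congr rfl fun u _ => ?_
  have h2 := sliceSym_mem_idealPerp u (castSym_mem_idealPerp (Nat.add_assoc d m₀ m).symm hv)
  -- Slices of `v` lie in `idealPerp I (d + m₀)`, where the penalty `Q` is zero.
  have h3 : A (sliceSym u (castSym (Nat.add_assoc d m₀ m).symm v)) =
      liftForm H m₀ (sliceSym u (castSym (Nat.add_assoc d m₀ m).symm v)) := by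
    simp [A, hQK _ h2]
  rw [h3]

end Hierarchy
end HermitianHierarchy

open HermitianHierarchy in
theorem mainTheorem9 {ι E : Type*} [Fintype ι] [NormedAddCommGroup E] [InnerProductSpace ℂ E]
    (b : OrthonormalBasis ι ℂ E) (d : ℕ)
    (H : symSubspace ι d →ₗ[ℂ] symSubspace ι d) (hH : LinearMap.IsSymmetric (𝕜 := ℂ) (E := symSubspace ι d) H)
    (I : Ideal (MvPolynomial ι ℂ))
    (hI : I.IsHomogeneous (MvPolynomial.homogeneousSubmodule ι ℂ)) :
    Monotone (fun m : ℕ => minEigenvalue (idealCompression I H m)) ∧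
    Filter.Tendsto (fun m : ℕ => minEigenvalue (idealCompression I H m)) Filter.atTop
      (nhds (⨅ z ∈ {z : E | InnerProductSpace.rankOne ℂ z z ∈ projVariety b I},
        (formValue b H z : EReal))) ∧
    ((projVariety b I).Nonempty →
      (∀ m : ℕ, ∃ ν : ℝ, minEigenvalue (idealCompression I H m) = (ν : EReal) ∧
        IsLeast {μ : ℝ | Module.End.HasEigenvalue (idealCompression I H m) (μ : ℂ)} ν) ∧
      ∃ a : ℝ,
        IsLeast (formValue b H '' {z : E | InnerProductSpace.rankOne ℂ z z ∈ projVariety b I}) a ∧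
        Filter.Tendsto (fun m : ℕ => minEigenvalue (idealCompression I H m)) Filter.atTop
          (nhds (a : EReal))) := by
  have hset : {z : E | InnerProductSpace.rankOne ℂ z z ∈ projVariety b I} =
      {z : E | ‖z‖ = 1 ∧ ∀ k, vecPow b k z ∈ idealPerp I k} :=
    Set.ext fun z => rankOne_mem_projVariety_iff b hI
  have hmono := monotone_minEigenvalue_idealCompression (I := I) hH
  have hlim : Filter.Tendsto (fun m : ℕ => minEigenvalue (idealCompression I H m)) Filter.atTop
      (nhds (⨅ z ∈ {z : E | InnerProductSpace.rankOne ℂ z z ∈ projVariety b I},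
        (formValue b H z : EReal))) := by
    have hsup : ⨆ m, minEigenvalue (idealCompression I H m) =
        ⨅ z ∈ {z : E | InnerProductSpace.rankOne ℂ z z ∈ projVariety b I},
          (formValue b H z : EReal) := by
      rw [hset]
      refine le_antisymm (iSup_le fun m => le_iInf₂ fun z hz =>
        minEigenvalue_idealCompression_le b hH m hz.1 (hz.2 _)) ?_
      refine EReal.ge_of_forall_gt_iff_ge.mp fun c hc => ?_
      -- The intermediate `c'` keeps a strict inequality on the variety, while `c' - c` is the error
      -- allowed in the lower bound. An empty variety, with infimum `⊤`, needs no separate case.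
      obtain ⟨c', hcc', hc'⟩ := EReal.lt_iff_exists_real_btwn.mp hc
      obtain ⟨m, hm⟩ := exists_sub_le_minEigenvalue_idealCompression b (I := I) hH (c := c')
        (fun z hz hzk => EReal.coe_lt_coe_iff.mp (hc'.trans_le (iInf₂_le z ⟨hz, hzk⟩)))
        (sub_pos.mpr (EReal.coe_lt_coe_iff.mp hcc'))
      rw [sub_sub_cancel] at hm
      exact hm.trans (le_iSup (fun m => minEigenvalue (idealCompression I H m)) m)
    rw [← hsup]
    exact tendsto_atTop_iSup hmono
  refine ⟨hmono, hlim, ?_⟩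
  rintro ⟨_, z₀, hz₀, hf, -⟩
  have hz₀' := (forall_eval_eq_zero_iff b hI).mp hf
  refine ⟨fun m => ?_, ?_⟩
  · have := nontrivial_idealPerp b hz₀ (hz₀' (d + m))
    obtain ⟨ν, h1, h2, -⟩ := exists_isLeast_idealCompression (I := I) hH m
    exact ⟨ν, h1, h2⟩
  · have : FiniteDimensional ℂ E := b.toBasis.finiteDimensional_of_finite
    have : ProperSpace E := FiniteDimensional.proper ℂ E
    have hcompact : IsCompact {z : E | ‖z‖ = 1 ∧ ∀ k, vecPow b k z ∈ idealPerp I k} := by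
      have h : {z : E | ‖z‖ = 1 ∧ ∀ k, vecPow b k z ∈ idealPerp I k} =
          Metric.sphere 0 1 ∩ ⋂ k, {z : E | vecPow b k z ∈ idealPerp I k} := by
        ext z
        simp
      rw [h]
      exact (isCompact_sphere (0 : E) 1).inter_right (isClosed_iInter fun k =>
        (Submodule.closed_of_finiteDimensional (idealPerp I k)).preimage (continuous_vecPow b k))
    rw [hset] at hlim ⊢
    obtain ⟨z, hz, hmin⟩ := hcompact.exists_isMinOn ⟨z₀, hz₀, hz₀'⟩
      (continuous_formValue b H).continuousOn
    refine ⟨formValue b H z, ⟨⟨z, hz, rfl⟩, ?_⟩, ?_⟩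
    · rintro _ ⟨y, hy, rfl⟩
      exact hmin hy
    · have h : ⨅ z ∈ {z : E | ‖z‖ = 1 ∧ ∀ k, vecPow b k z ∈ idealPerp I k},
          (formValue b H z : EReal) = (formValue b H z : EReal) :=
        le_antisymm (iInf₂_le z hz) (le_iInf₂ fun y hy => by exact_mod_cast hmin hy)
      rwa [h] at hlim
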